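/- **Notation.** $\mathbb H$ is the skew field of quaternions, $\mathbb S=\{I\in\mathbb H: I^2=-1\}$, and for $I\in\mathbb S$ the slice $\mathbb C_I=\mathbb R+\mathbb R I$ carries the Lebesgue measure $d\lambda_I=dx\,dy$, $q=x+Iy$. For $f:\mathbb H\to\mathbb H$ let $f_I=f|_{\mathbb C_I}$ and, on $\mathbb C_I$, $$\partial_I f=\tfrac12(\partial_x-I\partial_y)f_I,\qquad \overline{\partial_I}f=\tfrac12(\partial_x+I\partial_y)f_I .$$ $f$ is a *slice function* if $f(x+Iy)=\alpha(x,y)+I\beta(x,y)$ for all $x,y\in\mathbb R$, $I\in\mathbb S$, with $\alpha,\beta:\mathbb R^2\to\mathbb H$, $\alpha$ even and $\beta$ odd in $y$; it is *slice regular* if moreover $\alpha,\beta$ are $C^1$ and $\overline{\partial_I}f=0$ on $\mathbb C_I$ for all $I\in\mathbb S$. The slice derivative of a (sufficiently smooth) slice function is $\partial_s f(q)=\partial_I f(q)$ for $q\in\mathbb C_I$; for real $q$ this does not depend on $I$. $L^2(\mathbb R,\mathbb H)$ is the right quaternionic Hilbert space of square integrable functions, with $\langle\varphi,\phi\rangle=\int_{\mathbb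 R}\overline{\phi(x)}\varphi(x)\,dx$. The quaternionic Segal–Bargmann transform of $\varphi\in L^2(\mathbb R,\mathbb H)$ is $$\mathcal B\varphi(q)=2^{3/4}\int_{\mathbb R}e^{-\pi(q^2+x^2)+2\pi\sqrt2\,qx}\varphi(x)\,dx,\qquad q\in\mathbb H .$$ For $n\ge 0$ and a slice regular $H:\mathbb H\to\mathbb H$ put $$T_nH(q)=(-1)^n\sqrt{\frac1{(2\pi)^n n!}}\;e^{2\pi|q|^2}\,\partial_s^n\!\left(e^{-2\pi|q|^2}H(q)\right).$$ The true quaternionic polyanalytic Bargmann transform is $B^{n+1}\varphi=T_n(\mathcal B\varphi)$. The true polyanalytic Fock space $\mathcal F_T^n(\mathbb H)$ (with respect to $I\in\mathbb S$) is the set of all functions $f=T_nH$, with $H:\mathbb H\to\mathbb H$ slice regular, such that $\int_{\mathbb C_I}|f_I(q)|^2e^{-2\pi|q|^2}\,d\lambda_I(q)<\infty$, with $$\langle f,g\rangle_{\mathcal F_T^n(\mathbb H)}=\int_{\mathbb C_I}\overline{g_I(q)}\,f_I(q)\,e^{-2\pi|q|^2}\,d\lambda_I(q),\qquad \|f\|^2_{\mathcal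 F_T^n(\mathbb H)}=\int_{\mathbb C_I}|f_I(q)|^2e^{-2\pi|q|^2}\,d\lambda_I(q).$$ **Theorem.** Let $n\ge 0$. For every $\varphi\in L^2(\mathbb R,\mathbb H)$ the integral defining $\mathcal B\varphi(q)$ converges absolutely for all $q\in\mathbb H$ and $\mathcal B\varphi$ is slice regular, so that $B^{n+1}\varphi$ is defined. The map $B^{n+1}$ is right $\mathbb H$-linear and, for every $I\in\mathbb S$, it is an isometric isomorphism from $L^2(\mathbb R,\mathbb H)$ onto $\mathcal F_T^n(\mathbb H)$ (taken with respect to $I$): it is a bijection onto that space, $\|B^{n+1}\varphi\|_{\mathcal F_T^n(\mathbb H)}=\|\varphi\|_{L^2(\mathbb R,\mathbb H)}$ for all $\varphi$, and $$\langle B^{n+1}\varphi,B^{n+1}\phi\rangle_{\mathcal F_T^n(\mathbb H)}=\langle\varphi,\phi\rangle_{L^2(\mathbb R,\mathbb H)}$$ for all $\varphi,\phi\in L^2(\mathbb R,\mathbb H)$, the integral on the left being absolutely convergent. -/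

import Mathlib

open MeasureTheory
open scoped Quaternion ENNReal

noncomputable section

namespace QBargmann

/-- The sphere of imaginary units of the quaternions. -/
def imagUnits : Set ℍ[ℝ] := {I | I ^ 2 = -1}

/-- The point `x + I y` of the slice `ℂ_I`, where `z = x + i y` is a complex number. -/
def toSlice (I : ℍ[ℝ]) (z : ℂ) : ℍ[ℝ] := (z.re : ℍ[ℝ]) + I * (z.im : ℍ[ℝ])

/-- `∂_I f = (∂_x - I ∂_y) f / 2`, at a point `q = x + I y` of the slice `ℂ_I`; `∂_x` and `∂_y` are
the derivatives of `f` in the directions `1` and `I`. -/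
def dSlice (I : ℍ[ℝ]) (f : ℍ[ℝ] → ℍ[ℝ]) (q : ℍ[ℝ]) : ℍ[ℝ] :=
  (1 / 2 : ℝ) • (lineDeriv ℝ f q 1 - I * lineDeriv ℝ f q I)

/-- `∂̄_I f = (∂_x + I ∂_y) f / 2`, at a point `q = x + I y` of the slice `ℂ_I`. -/
def dbarSlice (I : ℍ[ℝ]) (f : ℍ[ℝ] → ℍ[ℝ]) (q : ℍ[ℝ]) : ℍ[ℝ] :=
  (1 / 2 : ℝ) • (lineDeriv ℝ f q 1 + I * lineDeriv ℝ f q I)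

/-- The (left) slice regular functions on the whole of the quaternions: slice functions
`f (x + I y) = α (x, y) + I β (x, y)` with `α` even and `β` odd in `y`, both continuously
differentiable, such that `∂̄_I f = 0` on every slice `ℂ_I`. -/
def IsSliceRegular (f : ℍ[ℝ] → ℍ[ℝ]) : Prop :=
  ∃ α β : ℝ × ℝ → ℍ[ℝ],
    ContDiff ℝ 1 α ∧ ContDiff ℝ 1 β ∧
    (∀ x y, α (x, -y) = α (x, y)) ∧ (∀ x y, β (x, -y) = -β (x, y)) ∧
    (∀ I ∈ imagUnits, ∀ z : ℂ, f (toSlice I z) = α (z.re, z.im) + I * β (z.re, z.im)) ∧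
    (∀ I ∈ imagUnits, ∀ z : ℂ, dbarSlice I f (toSlice I z) = 0)

/-- The quaternion `i`. -/
def quatI : ℍ[ℝ] := ⟨0, 1, 0, 0⟩

open Classical in
/-- An imaginary unit `I` with `q ∈ ℂ_I`: it is `Im q / |Im q|` if `q` is not real. At a real `q`
every slice contains `q`, and `i` is taken. -/
def sliceUnit (q : ℍ[ℝ]) : ℍ[ℝ] :=
  if q.im = 0 then quatI else ‖q.im‖⁻¹ • q.im

/-- The slice derivative `∂_s f (q) = ∂_I f (q)` for `q ∈ ℂ_I`. For a differentiable slice function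
`f = α + I β` the value of `∂_I f` at a real point is `(∂_x α + ∂_y β) / 2` for all `I`, so that the
choice of `I` does not matter there; if `f` is slice regular it is `∂_x f`. -/
def sliceDeriv (f : ℍ[ℝ] → ℍ[ℝ]) (q : ℍ[ℝ]) : ℍ[ℝ] := dSlice (sliceUnit q) f q

/-- `(-1)^n ((2π)^n n!)^{-1/2} e^{2π|q|²} ∂_s^n (e^{-2π|q|²} H (q))`. -/
def polyRaise (n : ℕ) (H : ℍ[ℝ] → ℍ[ℝ]) (q : ℍ[ℝ]) : ℍ[ℝ] :=
  ((-1) ^ n * Real.sqrt (1 / ((2 * Real.pi) ^ n * (n.factorial : ℝ))) *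
      Real.exp (2 * Real.pi * ‖q‖ ^ 2)) •
    (sliceDeriv^[n] (fun p => Real.exp (-(2 * Real.pi) * ‖p‖ ^ 2) • H p)) q

/-- The inner product `∫_{ℂ_I} conj (g_I) f_I e^{-2π|q|²} dλ_I`. -/
def fockInner (I : ℍ[ℝ]) (f g : ℍ[ℝ] → ℍ[ℝ]) : ℍ[ℝ] :=
  ∫ z : ℂ, Real.exp (-(2 * Real.pi) * ‖toSlice I z‖ ^ 2) •
    (star (g (toSlice I z)) * f (toSlice I z))

/-- The norm `(∫_{ℂ_I} |f_I|² e^{-2π|q|²} dλ_I)^{1/2}`. -/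
def fockNorm (I : ℍ[ℝ]) (f : ℍ[ℝ] → ℍ[ℝ]) : ℝ :=
  Real.sqrt (∫ z : ℂ, ‖f (toSlice I z)‖ ^ 2 * Real.exp (-(2 * Real.pi) * ‖toSlice I z‖ ^ 2))

/-- The quaternionic true polyanalytic Fock space `F_T^n(ℍ)`, with the integrability condition on
the slice `ℂ_I`. -/
def trueFock (n : ℕ) (I : ℍ[ℝ]) : Set (ℍ[ℝ] → ℍ[ℝ]) :=
  {f | Integrable (fun z : ℂ =>
        ‖f (toSlice I z)‖ ^ 2 * Real.exp (-(2 * Real.pi) * ‖toSlice I z‖ ^ 2)) ∧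
      ∃ H : ℍ[ℝ] → ℍ[ℝ], IsSliceRegular H ∧ f = polyRaise n H}

/-- The kernel `(ν/π)^{3/4} exp (-(ν/2) (q² + x²) + ν √2 q x)`. -/
def bargmannKernel (ν : ℝ) (q : ℍ[ℝ]) (x : ℝ) : ℍ[ℝ] :=
  ((ν / Real.pi) ^ (3 / 4 : ℝ)) •
    NormedSpace.exp ((-(ν / 2)) • (q ^ 2 + (x : ℍ[ℝ]) ^ 2) + (ν * Real.sqrt 2) • (q * (x : ℍ[ℝ])))

/-- `L²(ℝ, ℍ)`. -/
abbrev L2 : Type := Lp ℍ[ℝ] 2 (volume : Measure ℝ)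

/-- The inner product `∫ conj (ψ x) φ x dx` of `L²(ℝ, ℍ)`. -/
def l2Inner (φ ψ : L2) : ℍ[ℝ] := ∫ x : ℝ, star (ψ x) * φ x

/-- The quaternionic Segal-Bargmann transform, with parameter `ν = 2π`. -/
def bargmann (φ : L2) (q : ℍ[ℝ]) : ℍ[ℝ] := ∫ x : ℝ, bargmannKernel (2 * Real.pi) q x * φ x

/-- The true quaternionic polyanalytic Bargmann transform `B^{n+1}`, of order `n + 1`. -/
def trueBargmann (n : ℕ) (φ : L2) : ℍ[ℝ] → ℍ[ℝ] := polyRaise n (bargmann φ)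

end QBargmann

end

/-! A slice function is encoded by four complex functions `g j`, one per real coordinate of its
values, with `g j (conj z) = conj (g j z)`; its value at `x + I y` is the quaternion of real parts
plus `I` times the quaternion of imaginary parts (`SliceRep`). In this encoding slice regularity
says that the components are entire, the slice derivative becomes the Wirtinger derivative ∂ of each
component, and the quaternionic transform becomes the classical Bargmann transform of the four real
coordinates of φ. On a slice the contributions of the components are not orthogonal pointwise, but
by the parallelogram law the cross terms cancel between `z` and `conj z`. Hence the squared norm on
any slice is the sum of those of the components (`SliceRep.lintegral_norm_sq`).

Two complex facts remain. The classical Bargmann transform is isometric, by Plancherel on vertical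
lines for test functions and then by density (`fockSq_scalarBargmann`); it is onto the Fock space,
because polynomials times a Gaussian produce all monomials (`exists_scalarBargmann_eq`). The
operator T_n is, up to its constant, the n-th power of ∂ − 2π conj z, and this power multiplies the
squared norm of every entire function by (2π)^n n! (`fockSq_creation`): on monomials by integration
by parts, in general by Parseval on circles.

The last identity holds in [0, ∞], so a finite norm of T_n H forces a finite norm of H; surjectivity
rests on this. Inner products follow from norms by polarization and right linearity. -/

namespace QBargmann

open scoped ComplexConjugate

/-! ### Wirtinger calculus -/

/-- The real derivative of `f` at `z` is `v ↦ a v + b conj v`, that is, `a` and `b` are the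
Wirtinger derivatives of `f` at `z`. -/
def HasWirtingerAt (f : ℂ → ℂ) (a b z : ℂ) : Prop :=
  HasFDerivAt f (a • (1 : ℂ →L[ℝ] ℂ) + b • (Complex.conjCLE : ℂ →L[ℝ] ℂ)) z

lemma HasWirtingerAt.congr {f : ℂ → ℂ} {a b a' b' z : ℂ} (h : HasWirtingerAt f a b z)
    (ha : a = a') (hb : b = b') : HasWirtingerAt f a' b' z := ha ▸ hb ▸ h

lemma HasWirtingerAt.sub {f g : ℂ → ℂ} {a b a' b' z : ℂ} (hf : HasWirtingerAt f a b z)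
    (hg : HasWirtingerAt g a' b' z) :
    HasWirtingerAt (fun z => f z - g z) (a - a') (b - b') z := by
  unfold HasWirtingerAt at *
  convert! hf.sub hg using 1
  ext v
  simp
  ring

lemma HasWirtingerAt.mul {f g : ℂ → ℂ} {a b a' b' z : ℂ} (hf : HasWirtingerAt f a b z)
    (hg : HasWirtingerAt g a' b' z) :
    HasWirtingerAt (fun z => f z * g z) (a * g z + f z * a') (b * g z + f z * b') z := by
  unfold HasWirtingerAt at *
  convert! hf.mul hg using 1
  ext v
  simp
  ring

lemma HasWirtingerAt.conj {f : ℂ → ℂ} {a b z : ℂ} (hf : HasWirtingerAt f a b z) :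
    HasWirtingerAt (fun z => conj (f z)) (conj b) (conj a) z := by
  unfold HasWirtingerAt at *
  convert! (Complex.conjCLE : ℂ →L[ℝ] ℂ).hasFDerivAt.comp z hf using 1
  ext v
  simp
  ring

lemma HasDerivAt.hasWirtingerAt {f : ℂ → ℂ} {a z : ℂ} (hf : HasDerivAt f a z) :
    HasWirtingerAt f a 0 z := by
  unfold HasWirtingerAt
  convert! hf.hasFDerivAt.restrictScalars ℝ using 1
  ext v
  simp
  ring

lemma HasWirtingerAt.cexp {f : ℂ → ℂ} {a b z : ℂ} (hf : HasWirtingerAt f a b z) :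
    HasWirtingerAt (fun z => Complex.exp (f z)) (Complex.exp (f z) * a)
      (Complex.exp (f z) * b) z := by
  unfold HasWirtingerAt at *
  convert! ((Complex.hasDerivAt_exp (f z)).hasFDerivAt.restrictScalars ℝ).comp z hf using 1
  ext v
  simp
  ring

lemma HasWirtingerAt.const_mul {f : ℂ → ℂ} {a b z : ℂ} (c : ℂ) (hf : HasWirtingerAt f a b z) :
    HasWirtingerAt (fun z => c * f z) (c * a) (c * b) z :=
  (HasWirtingerAt.mul (HasDerivAt.hasWirtingerAt (hasDerivAt_const z c)) hf).congr
    (by simp) (by simp)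

lemma hasWirtingerAt_id (z : ℂ) : HasWirtingerAt (fun z => z) 1 0 z :=
  HasDerivAt.hasWirtingerAt (hasDerivAt_id z)

lemma hasWirtingerAt_conj (z : ℂ) : HasWirtingerAt (fun z => conj z) 0 1 z := by
  simpa using (hasWirtingerAt_id z).conj

lemma HasWirtingerAt.continuousAt {f : ℂ → ℂ} {a b z : ℂ} (hf : HasWirtingerAt f a b z) :
    ContinuousAt f z := HasFDerivAt.continuousAt hf

lemma HasWirtingerAt.hasDerivAt_line {f : ℂ → ℂ} {a b z : ℂ} (hf : HasWirtingerAt f a b z)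
    (v : ℂ) : HasDerivAt (fun t : ℝ => f (z + t * v)) (a * v + b * conj v) 0 := by
  have := HasFDerivAt.hasLineDerivAt hf v
  unfold HasLineDerivAt at this
  simpa using this

/-! ### The Gaussian weight and the creation operator -/

/-- The weight `e^{-2π|z|²}` of the Fock space. -/
noncomputable def gaussWeight (z : ℂ) : ℝ := Real.exp (-(2 * Real.pi) * ‖z‖ ^ 2)

lemma ofReal_gaussWeight (z : ℂ) :
    (gaussWeight z : ℂ) = Complex.exp (-(2 * Real.pi) * (z * conj z)) := by
  rw [gaussWeight, Complex.mul_conj, Complex.normSq_eq_norm_sq]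
  push_cast
  rfl

lemma gaussWeight_pos (z : ℂ) : 0 < gaussWeight z := Real.exp_pos _

lemma continuous_gaussWeight : Continuous gaussWeight := by
  unfold gaussWeight; fun_prop

lemma gaussWeight_conj (z : ℂ) : gaussWeight (conj z) = gaussWeight z := by
  simp [gaussWeight]

lemma hasWirtingerAt_gaussWeight (z : ℂ) :
    HasWirtingerAt (fun z => (gaussWeight z : ℂ)) (-(2 * Real.pi) * conj z * gaussWeight z)
      (-(2 * Real.pi) * z * gaussWeight z) z := by
  have := (((hasWirtingerAt_id z).mul (hasWirtingerAt_conj z)).const_mul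
    (-(2 * Real.pi))).cexp
  simp_rw [← ofReal_gaussWeight] at this
  exact this.congr (by ring) (by ring)

/-- The `n`-th power of `∂ - 2π conj z`, applied to an entire function `g`. -/
noncomputable def creation : ℕ → (ℂ → ℂ) → ℂ → ℂ
  | 0, g => g
  | n + 1, g => fun z => creation n (deriv g) z - 2 * Real.pi * conj z * creation n g z

lemma creation_succ (n : ℕ) (g : ℂ → ℂ) (z : ℂ) :
    creation (n + 1) g z = creation n (deriv g) z - 2 * Real.pi * conj z * creation n g z := rfl

lemma differentiable_deriv {g : ℂ → ℂ} (hg : Differentiable ℂ g) : Differentiable ℂ (deriv g) :=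
  fun z => (hg.contDiff.differentiable_deriv_two z)

/-- `∂̄` lowers the degree in `conj z`. -/
noncomputable def creationBar : ℕ → (ℂ → ℂ) → ℂ → ℂ
  | 0, _ => 0
  | n + 1, g => fun z => -(2 * Real.pi) * (n + 1) * creation n g z

/-- The commutator of ∂̄ with ∂ − 2π conj z is −2π and ∂̄ kills `g`, so each of the factors of the
power contributes −2π times the next lower power. -/
lemma hasWirtingerAt_creation (n : ℕ) {g : ℂ → ℂ} (hg : Differentiable ℂ g) (z : ℂ) :
    HasWirtingerAt (creation n g) (creation n (deriv g) z) (creationBar n g z) z := by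
  induction n generalizing g with
  | zero => exact HasDerivAt.hasWirtingerAt (hg z).hasDerivAt
  | succ n ih =>
    have h := (ih (differentiable_deriv hg)).sub
      (((hasWirtingerAt_conj z).const_mul (2 * Real.pi)).mul (ih hg))
    refine h.congr ?_ ?_
    · simp [creation_succ]
    · cases n with
      | zero => simp [creationBar, creation]
      | succ n =>
        simp only [creationBar, creation_succ n g]
        push_cast
        ring

lemma continuous_creation (n : ℕ) {g : ℂ → ℂ} (hg : Differentiable ℂ g) :
    Continuous (creation n g) :=
  continuous_iff_continuousAt.2 fun z => (hasWirtingerAt_creation n hg z).continuousAt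

/-- Conjugation by the weight turns ∂ into ∂ − 2π conj z. Iterated, this evaluates the derivatives
in `polyRaise`. -/
lemma hasWirtingerAt_weight_mul_creation (n : ℕ) {g : ℂ → ℂ} (hg : Differentiable ℂ g) (z : ℂ) :
    HasWirtingerAt (fun z => gaussWeight z * creation n g z)
      (gaussWeight z * creation (n + 1) g z)
      (gaussWeight z * (creationBar n g z - 2 * Real.pi * z * creation n g z)) z :=
  ((hasWirtingerAt_gaussWeight z).mul (hasWirtingerAt_creation n hg z)).congr
    (by rw [creation_succ]; ring) (by ring)

lemma creation_add (n : ℕ) {f g : ℂ → ℂ} (hf : Differentiable ℂ f) (hg : Differentiable ℂ g) :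
    creation n (f + g) = creation n f + creation n g := by
  induction n generalizing f g with
  | zero => rfl
  | succ n ih =>
    have : deriv (f + g) = deriv f + deriv g := funext fun z => deriv_add (hf z) (hg z)
    ext z
    simp only [creation_succ, this, ih (differentiable_deriv hf) (differentiable_deriv hg),
      ih hf hg, Pi.add_apply]
    ring

lemma creation_zero_fun (n : ℕ) : creation n (fun _ => 0) = fun _ => 0 := by
  induction n with
  | zero => rfl
  | succ n ih => ext z; simp [creation_succ, ih]

lemma creation_conj (n : ℕ) {g : ℂ → ℂ} (hg : ∀ z, g (conj z) = conj (g z)) (z : ℂ) :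
    creation n g (conj z) = conj (creation n g z) := by
  induction n generalizing g with
  | zero => exact hg z
  | succ n ih =>
    have h : ∀ z, deriv g (conj z) = conj (deriv g z) := by
      have h1 : (starRingEnd ℂ) ∘ g ∘ (starRingEnd ℂ) = g := by
        ext w; simp [hg]
      have h2 := deriv_conj_conj (f := g)
      rw [h1] at h2
      intro w
      have h3 := congrFun h2 (conj w)
      simpa using h3
    simp only [creation_succ, ih h, ih hg, map_sub, map_mul, Complex.conj_conj, map_ofNat,
      Complex.conj_ofReal]

/-- The normalized monomial `z ^ k / k!`. -/
noncomputable def divMonomial (k : ℕ) (z : ℂ) : ℂ := z ^ k / k.factorial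

lemma differentiable_divMonomial (k : ℕ) : Differentiable ℂ (divMonomial k) := by
  unfold divMonomial; fun_prop

lemma deriv_divMonomial_zero : deriv (divMonomial 0) = fun _ => 0 := by
  have : divMonomial 0 = fun _ => 1 := by ext z; simp [divMonomial]
  rw [this]; simp

lemma deriv_divMonomial_succ (k : ℕ) : deriv (divMonomial (k + 1)) = divMonomial k := by
  ext z
  have : HasDerivAt (divMonomial (k + 1)) _ z :=
    ((hasDerivAt_pow (k + 1) z).div_const ((k + 1).factorial : ℂ))
  rw [this.deriv, divMonomial, Nat.factorial_succ]
  have h1 : ((k : ℂ) + 1) ≠ 0 := by exact_mod_cast k.succ_ne_zero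
  have h2 : (k.factorial : ℂ) ≠ 0 := by exact_mod_cast k.factorial_ne_zero
  push_cast
  field_simp

/-- Both ∂ and multiplication by conj z lower the weight under rotations by one, so this function
has weight k − n; the factor `u ^ n` keeps all exponents nonnegative. Different k are therefore
orthogonal on every circle about 0. -/
lemma creation_divMonomial_rotate (n k : ℕ) {u : ℂ} (hu : ‖u‖ = 1) (z : ℂ) :
    u ^ n * creation n (divMonomial k) (u * z) = u ^ k * creation n (divMonomial k) z := by
  have huu : u * conj u = 1 := by
    rw [Complex.mul_conj, Complex.normSq_eq_norm_sq, hu]; simp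
  induction n generalizing k with
  | zero => simp [creation, divMonomial, mul_pow]; ring
  | succ n ih =>
    cases k with
    | zero =>
      have := ih 0
      simp only [creation_succ, deriv_divMonomial_zero, creation_zero_fun, map_mul]
      linear_combination (-(2 * Real.pi) * conj z * u * conj u) * this +
        (-(2 * Real.pi) * conj z * (creation n (divMonomial 0) z)) * huu
    | succ k =>
      have h1 := ih (k + 1)
      have h2 := ih k
      simp only [creation_succ, deriv_divMonomial_succ, map_mul]
      linear_combination u * h2 + (-(2 * Real.pi) * conj z * u * conj u) * h1 +
        (-(2 * Real.pi) * conj z * u ^ (k + 1) * (creation n (divMonomial (k + 1)) z)) * huu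

lemma hasSum_creation (n : ℕ) {g : ℂ → ℂ} (hg : Differentiable ℂ g) (z : ℂ) :
    HasSum (fun k => iteratedDeriv k g 0 * creation n (divMonomial k) z) (creation n g z) := by
  induction n generalizing g with
  | zero =>
    convert! Complex.hasSum_taylorSeries_of_entire hg 0 z using 1
    ext k
    simp [creation, divMonomial]
    ring
  | succ n ih =>
    have h1 := ih (differentiable_deriv hg)
    have h2 := (ih hg).mul_left (2 * Real.pi * conj z)
    have h3 : HasSum (fun k => iteratedDeriv k g 0 * creation n (deriv (divMonomial k)) z)
        (creation n (deriv g) z) := by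
      -- The term k = 0 vanishes because `divMonomial 0` is constant; the others are the Taylor
      -- terms of `deriv g`, shifted by one.
      rw [← hasSum_nat_add_iff' 1]
      simpa [deriv_divMonomial_zero, creation_zero_fun, deriv_divMonomial_succ,
        iteratedDeriv_succ'] using h1
    convert! h3.sub h2 using 1
    ext k
    rw [creation_succ]
    ring

/-! ### Polynomial growth and integrability against the weight -/

/-- Continuous functions on the plane of at most polynomial growth. -/
def PolyGrowth (f : ℂ → ℂ) : Prop :=
  Continuous f ∧ ∃ (C : ℝ) (m : ℕ), ∀ z, ‖f z‖ ≤ C * (1 + ‖z‖) ^ m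

lemma PolyGrowth.mul {f g : ℂ → ℂ} (hf : PolyGrowth f) (hg : PolyGrowth g) :
    PolyGrowth (fun z => f z * g z) := by
  obtain ⟨hfc, C, m, hC⟩ := hf
  obtain ⟨hgc, D, l, hD⟩ := hg
  refine ⟨hfc.mul hgc, C * D, m + l, fun z => ?_⟩
  rw [norm_mul, pow_add, mul_mul_mul_comm]
  exact mul_le_mul (hC z) (hD z) (norm_nonneg _) ((norm_nonneg _).trans (hC z))

lemma PolyGrowth.conj {f : ℂ → ℂ} (hf : PolyGrowth f) : PolyGrowth (fun z => conj (f z)) :=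
  ⟨Complex.continuous_conj.comp hf.1, by simpa using hf.2⟩

lemma PolyGrowth.sub {f g : ℂ → ℂ} (hf : PolyGrowth f) (hg : PolyGrowth g) :
    PolyGrowth (fun z => f z - g z) := by
  obtain ⟨hfc, C, m, hC⟩ := hf
  obtain ⟨hgc, D, l, hD⟩ := hg
  have hC0 : 0 ≤ C := by simpa using (norm_nonneg _).trans (hC 0)
  have hD0 : 0 ≤ D := by simpa using (norm_nonneg _).trans (hD 0)
  refine ⟨hfc.sub hgc, C + D, m + l, fun z => (norm_sub_le _ _).trans ?_⟩
  have h1 : (1 : ℝ) ≤ 1 + ‖z‖ := by simp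
  rw [add_mul]
  gcongr
  · exact (hC z).trans (by gcongr; omega)
  · exact (hD z).trans (by gcongr; omega)

lemma polyGrowth_const (c : ℂ) : PolyGrowth (fun _ => c) :=
  ⟨continuous_const, ‖c‖, 0, by simp⟩

lemma polyGrowth_id : PolyGrowth (fun z => z) := ⟨continuous_id, 1, 1, by simp⟩

lemma polyGrowth_divMonomial (k : ℕ) : PolyGrowth (divMonomial k) := by
  refine ⟨(differentiable_divMonomial k).continuous, 1, k, fun z => ?_⟩
  rw [divMonomial, norm_div, norm_pow, one_mul, Complex.norm_natCast]
  refine (div_le_self (by positivity) ?_).trans ?_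
  · exact_mod_cast k.factorial_pos
  · gcongr; simp

lemma polyGrowth_creation (n k : ℕ) : PolyGrowth (creation n (divMonomial k)) := by
  induction n generalizing k with
  | zero => exact polyGrowth_divMonomial k
  | succ n ih =>
    refine PolyGrowth.sub ?_ (((polyGrowth_const _).mul polyGrowth_id.conj).mul (ih k))
    cases k with
    | zero =>
      rw [deriv_divMonomial_zero, creation_zero_fun]
      exact polyGrowth_const 0
    | succ k => rw [deriv_divMonomial_succ]; exact ih k

lemma polyGrowth_creationBar (n k : ℕ) : PolyGrowth (creationBar n (divMonomial k)) := by
  cases n with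
  | zero => exact polyGrowth_const 0
  | succ n => exact (polyGrowth_const _).mul (polyGrowth_creation n k)

lemma PolyGrowth.integrable {f : ℂ → ℂ} (hf : PolyGrowth f) :
    Integrable (fun z => gaussWeight z * f z) := by
  obtain ⟨hfc, C, m, hC⟩ := hf
  have hC0 : 0 ≤ C := by simpa using (norm_nonneg _).trans (hC 0)
  -- Three surplus powers are absorbed by the Gaussian, leaving a decay of order 3 > 2, integrable
  -- on the plane.
  have h3 : Integrable (fun z : ℂ => (1 + ‖z‖) ^ (-(3 : ℝ))) :=
    integrable_one_add_norm (by simp; norm_num)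
  refine (h3.const_mul (C * (m + 3).factorial * Real.exp 2)).mono'
    ((Complex.continuous_ofReal.comp continuous_gaussWeight).mul hfc).aestronglyMeasurable
    (Filter.Eventually.of_forall fun z => ?_)
  have h0 : 0 < 1 + ‖z‖ := by positivity
  have h1 : (1 + ‖z‖) ^ (m + 3) ≤ (m + 3).factorial * Real.exp (1 + ‖z‖) := by
    have := Real.pow_div_factorial_le_exp (1 + ‖z‖) h0.le (m + 3)
    rw [div_le_iff₀ (by positivity)] at this
    linarith
  have h2 : gaussWeight z * Real.exp (1 + ‖z‖) ≤ Real.exp 2 := by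
    rw [gaussWeight, ← Real.exp_add]
    apply Real.exp_le_exp.2
    nlinarith [Real.pi_gt_three, norm_nonneg z, sq_nonneg (‖z‖ - 1 / 2), sq_nonneg ‖z‖]
  have h4 : (1 + ‖z‖) ^ (-(3 : ℝ)) = ((1 + ‖z‖) ^ 3)⁻¹ := by
    rw [Real.rpow_neg h0.le]; norm_cast
  rw [norm_mul, Complex.norm_real, Real.norm_of_nonneg (gaussWeight_pos z).le, h4,
    ← div_eq_mul_inv, le_div_iff₀ (by positivity)]
  calc gaussWeight z * ‖f z‖ * (1 + ‖z‖) ^ 3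
      ≤ gaussWeight z * (C * (1 + ‖z‖) ^ m) * (1 + ‖z‖) ^ 3 := by
        gcongr
        · exact (gaussWeight_pos z).le
        · exact hC z
    _ = C * gaussWeight z * (1 + ‖z‖) ^ (m + 3) := by ring
    _ ≤ C * gaussWeight z * ((m + 3).factorial * Real.exp (1 + ‖z‖)) := by
        have := (gaussWeight_pos z).le
        gcongr
    _ = C * (m + 3).factorial * (gaussWeight z * Real.exp (1 + ‖z‖)) := by ring
    _ ≤ C * (m + 3).factorial * Real.exp 2 := by gcongr

/-! ### Integration by parts and the norms of the raised monomials -/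

lemma integral_hasFDerivAt_eq_zero {F : ℂ → ℂ} {F' : ℂ → ℂ →L[ℝ] ℂ} (v : ℂ)
    (hF : ∀ z, HasFDerivAt F (F' z) z) (h : Integrable F) (h' : Integrable fun z => F' z v) :
    ∫ z, F' z v = 0 := by
  have := integral_bilinear_hasFDerivAt_right_eq_neg_left_of_integrable (μ := volume)
    (f := fun _ : ℂ => (1 : ℂ)) (f' := fun _ => 0) (g := F) (g' := F') (v := v)
    (B := ContinuousLinearMap.mul ℝ ℂ) (by simp) (by simpa using h') (by simpa using h)
    (fun z _ => hasFDerivAt_const _ _) (fun z _ => hF z)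
  simpa using this

/-- The derivatives in the directions 1 and i integrate to zero, that is, ∫ (a + b) = 0 and i ∫ (a −
b) = 0. -/
lemma integral_wirtinger_eq_zero {F a b : ℂ → ℂ} (hF : ∀ z, HasWirtingerAt F (a z) (b z) z)
    (h : Integrable F) (ha : Integrable a) (hb : Integrable b) : ∫ z, a z = 0 := by
  have h1 := integral_hasFDerivAt_eq_zero 1 hF h (by simpa using! ha.add hb)
  have h2 := integral_hasFDerivAt_eq_zero Complex.I hF h
    (by simpa using! (ha.mul_const Complex.I).add (hb.mul_const (-Complex.I)))
  simp only [_root_.add_apply, _root_.smul_apply, smul_eq_mul,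
    one_apply_eq_self, ContinuousLinearEquiv.coe_coe, Complex.conjCLE_apply,
    map_one, mul_one, Complex.conj_I] at h1 h2
  rw [integral_add ha hb] at h1
  rw [integral_add (ha.mul_const _) (hb.mul_const _), integral_mul_const,
    integral_mul_const] at h2
  linear_combination (1 / 2) * h1 - (Complex.I / 2) * h2 +
    ((1 / 2 : ℂ) * (∫ z, a z) - (1 / 2) * ∫ z, b z) * Complex.I_mul_I

lemma integrable_norm_sq_creation (n k : ℕ) :
    Integrable fun z => ‖creation n (divMonomial k) z‖ ^ 2 * gaussWeight z := by
  have := ((polyGrowth_creation n k).mul (polyGrowth_creation n k).conj).integrable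
  convert! this.re using 1
  ext z
  rw [Complex.mul_conj, Complex.normSq_eq_norm_sq, ← Complex.ofReal_mul, mul_comm]
  exact (Complex.ofReal_re _).symm

/-- With weight w and u_m the m-th raised monomial, integrate ∂ (w u_n conj u_{n+1}). Here ∂ (w u_n)
= w u_{n+1}, while ∂ (conj u_{n+1}) is the conjugate of ∂̄ u_{n+1} = −2π (n + 1) u_n: the creation
operator is adjoint to −∂̄. -/
lemma integral_norm_sq_creation_succ (n k : ℕ) :
    ∫ z, ‖creation (n + 1) (divMonomial k) z‖ ^ 2 * gaussWeight z =
      2 * Real.pi * (n + 1) * ∫ z, ‖creation n (divMonomial k) z‖ ^ 2 * gaussWeight z := by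
  have hd := differentiable_divMonomial k
  have hu := polyGrowth_creation n k
  have hv := polyGrowth_creation (n + 1) k
  have key := integral_wirtinger_eq_zero
    (F := fun z => gaussWeight z * creation n (divMonomial k) z *
      conj (creation (n + 1) (divMonomial k) z))
    (a := fun z => ((‖creation (n + 1) (divMonomial k) z‖ ^ 2 * gaussWeight z -
      2 * Real.pi * (n + 1) * (‖creation n (divMonomial k) z‖ ^ 2 * gaussWeight z) : ℝ) : ℂ))
    -- Only the integrability of this ∂̄ derivative matters; the sum is written as a difference so
    -- that `PolyGrowth.sub` applies.
    (b := fun z => gaussWeight z * ((creationBar n (divMonomial k) z -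
      2 * Real.pi * z * creation n (divMonomial k) z) * conj (creation (n + 1) (divMonomial k) z) -
      (-1) * creation n (divMonomial k) z * conj (creation (n + 1) (deriv (divMonomial k)) z)))
    (fun z => ?_) ?_ ?_ ?_
  · rw [integral_complex_ofReal, Complex.ofReal_eq_zero,
      integral_sub (integrable_norm_sq_creation _ _)
        ((integrable_norm_sq_creation _ _).const_mul _), integral_const_mul] at key
    linarith
  · refine ((hasWirtingerAt_weight_mul_creation n hd z).mul
      (hasWirtingerAt_creation (n + 1) hd z).conj).congr ?_ (by ring)
    have h1 := Complex.mul_conj' (creation (n + 1) (divMonomial k) z)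
    have h2 := Complex.mul_conj' (creation n (divMonomial k) z)
    simp only [creationBar, map_mul, map_neg, map_add, map_one, map_natCast, Complex.conj_ofReal,
      map_ofNat]
    push_cast
    linear_combination (gaussWeight z : ℂ) * h1 - gaussWeight z * (2 * Real.pi * (n + 1)) * h2
  · simpa [mul_assoc] using (hu.mul hv.conj).integrable
  · exact ((integrable_norm_sq_creation _ _).sub
      ((integrable_norm_sq_creation _ _).const_mul _)).ofReal
  · have hdv : PolyGrowth (creation (n + 1) (deriv (divMonomial k))) := by
      cases k with
      | zero =>
        rw [deriv_divMonomial_zero, creation_zero_fun]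
        exact polyGrowth_const 0
      | succ k => rw [deriv_divMonomial_succ]; exact polyGrowth_creation _ _
    exact ((((polyGrowth_creationBar n k).sub (((polyGrowth_const _).mul polyGrowth_id).mul
      hu)).mul hv.conj).sub (((polyGrowth_const _).mul hu).mul hdv.conj)).integrable

lemma integral_norm_sq_creation (n k : ℕ) :
    ∫ z, ‖creation n (divMonomial k) z‖ ^ 2 * gaussWeight z =
      (2 * Real.pi) ^ n * n.factorial * ∫ z, ‖divMonomial k z‖ ^ 2 * gaussWeight z := by
  induction n with
  | zero => simp [creation]
  | succ n ih =>
    rw [integral_norm_sq_creation_succ, ih, Nat.factorial_succ]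
    push_cast
    ring

/-- The square of the norm of the weighted `L²` space, possibly infinite. -/
noncomputable def fockSq (g : ℂ → ℂ) : ℝ≥0∞ :=
  ∫⁻ z, ENNReal.ofReal (‖g z‖ ^ 2 * gaussWeight z)

lemma fockSq_creation_divMonomial (n k : ℕ) :
    fockSq (creation n (divMonomial k)) =
      ENNReal.ofReal ((2 * Real.pi) ^ n * n.factorial) * fockSq (divMonomial k) := by
  have h0 : Integrable fun z => ‖divMonomial k z‖ ^ 2 * gaussWeight z :=
    integrable_norm_sq_creation 0 k
  have hpos : ∀ g : ℂ → ℂ, 0 ≤ᵐ[volume] fun z => ‖g z‖ ^ 2 * gaussWeight z := fun g =>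
    Filter.Eventually.of_forall fun z => mul_nonneg (sq_nonneg _) (gaussWeight_pos z).le
  rw [fockSq, fockSq, ← ofReal_integral_eq_lintegral_ofReal (integrable_norm_sq_creation n k)
    (hpos _), ← ofReal_integral_eq_lintegral_ofReal h0 (hpos _),
    ← ENNReal.ofReal_mul (by positivity), integral_norm_sq_creation]

lemma fockSq_divMonomial_lt_top (k : ℕ) : fockSq (divMonomial k) < ∞ :=
  (integrable_norm_sq_creation 0 k).lintegral_lt_top

/-! ### Parseval on circles -/

lemma hasSum_norm_sq_of_orthonormal {E : Type*} [NormedAddCommGroup E] [InnerProductSpace ℂ E]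
    {v : ℕ → E} (hv : Orthonormal ℂ v) {c : ℕ → ℂ} {x : E} (h : HasSum (fun k => c k • v k) x) :
    HasSum (fun k => ‖c k‖ ^ 2) (‖x‖ ^ 2) := by
  have h1 : Filter.Tendsto (fun s : Finset ℕ => ‖∑ k ∈ s, c k • v k‖ ^ 2) Filter.atTop
    (nhds (‖x‖ ^ 2)) := (Filter.Tendsto.norm h).pow 2
  refine h1.congr fun s => ?_
  have h2 := hv.inner_sum c c s
  rw [inner_self_eq_norm_sq_to_K] at h2
  have h3 : ∀ i, conj (c i) * c i = ((‖c i‖ ^ 2 : ℝ) : ℂ) := fun i => by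
    rw [Complex.conj_mul']; norm_cast
  simp_rw [h3, ← Complex.ofReal_sum] at h2
  exact Complex.ofReal_injective (by simpa using h2)

/-- Summable coefficients make the series converge uniformly, so it also converges in L² of the
circle, where the exponentials are orthonormal. -/
lemma lintegral_norm_sq_fourier_series {c : ℕ → ℂ} (hc : Summable c)
    {F : AddCircle (1 : ℝ) → ℂ} (hF : ∀ θ, HasSum (fun k : ℕ => c k * fourier (k : ℤ) θ) (F θ)) :
    ∫⁻ θ, ENNReal.ofReal (‖F θ‖ ^ 2) ∂AddCircle.haarAddCircle =
      ∑' k, ENNReal.ofReal (‖c k‖ ^ 2) := by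
  have hs : Summable fun k : ℕ => c k • (fourier (k : ℤ) : C(AddCircle (1 : ℝ), ℂ)) := by
    refine Summable.of_norm ?_
    simpa only [norm_smul, fourier_norm, mul_one] using hc.norm
  obtain ⟨f, hf⟩ := hs
  have hfF : ∀ θ, f θ = F θ := fun θ => by
    have := ContinuousMap.hasSum_apply hf θ
    exact this.unique (by simpa [-fourier_apply] using hF θ)
  have h1 := hf.mapL (ContinuousMap.toLp (E := ℂ) 2
    (AddCircle.haarAddCircle (T := 1)) ℂ)
  simp only [map_smul] at h1
  have h2 := hasSum_norm_sq_of_orthonormal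
    ((orthonormal_fourier (T := 1)).comp (fun k : ℕ => (k : ℤ)) Nat.cast_injective) h1
  have h3 := ContinuousMap.inner_toLp (𝕜 := ℂ) (AddCircle.haarAddCircle (T := 1)) f f
  rw [inner_self_eq_norm_sq_to_K] at h3
  have h4 : ∀ θ, f θ * conj (f θ) = ((‖F θ‖ ^ 2 : ℝ) : ℂ) := fun θ => by
    rw [Complex.mul_conj', hfF]; norm_cast
  simp_rw [h4] at h3
  rw [integral_complex_ofReal] at h3
  have h5 : ‖ContinuousMap.toLp (E := ℂ) 2 (AddCircle.haarAddCircle (T := 1)) ℂ f‖ ^ 2 =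
    ∫ θ, ‖F θ‖ ^ 2 ∂AddCircle.haarAddCircle :=
    Complex.ofReal_injective (by simpa using h3)
  have hFc : Continuous F := by
    have : F = f := funext fun θ => (hfF θ).symm
    rw [this]; exact f.continuous
  rw [← ofReal_integral_eq_lintegral_ofReal _ (Filter.Eventually.of_forall fun θ => sq_nonneg _),
    ← h5, ← h2.tsum_eq, ENNReal.ofReal_tsum_of_nonneg (fun _ => sq_nonneg _) h2.summable]
  exact (hFc.norm.pow 2).integrable_of_hasCompactSupport (HasCompactSupport.of_compactSpace _)

lemma fockSq_rotate (g : ℂ → ℂ) (u : Circle) : fockSq (fun z => g (u * z)) = fockSq g := by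
  have h := (rotation u).measurePreserving.lintegral_comp_emb
    (rotation u).toHomeomorph.measurableEmbedding
    (fun z => ENNReal.ofReal (‖g z‖ ^ 2 * gaussWeight z))
  rw [fockSq, fockSq, ← h]
  refine lintegral_congr fun z => ?_
  simp [gaussWeight, Circle.norm_coe]

/-- Orthogonality of the functions `creation n (divMonomial k)`, in the form of a Parseval
identity in which both sides may be infinite. -/
lemma fockSq_hasSum (n : ℕ) {G : ℂ → ℂ} (hG : Continuous G) {b : ℕ → ℂ}
    (h : ∀ z, HasSum (fun k => b k * creation n (divMonomial k) z) (G z)) :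
    fockSq G = ∑' k, ENNReal.ofReal (‖b k‖ ^ 2) * fockSq (creation n (divMonomial k)) := by
  have key : ∀ z, ∫⁻ θ : AddCircle (1 : ℝ), ENNReal.ofReal (‖G (θ.toCircle * z)‖ ^ 2)
      ∂AddCircle.haarAddCircle =
      ∑' k, ENNReal.ofReal (‖b k * creation n (divMonomial k) z‖ ^ 2) := by
    intro z
    -- The unimodular factor `θ ^ n` leaves the norm unchanged and shifts the frequencies k − n to k
    -- ≥ 0.
    rw [← lintegral_norm_sq_fourier_series (h z).summable
      (F := fun θ => (θ.toCircle : ℂ) ^ n * G (θ.toCircle * z))]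
    · simp [Circle.norm_coe]
    · intro θ
      refine ((h (θ.toCircle * z)).mul_left ((θ.toCircle : ℂ) ^ n)).congr_fun fun k => ?_
      have := creation_divMonomial_rotate n k (Circle.norm_coe θ.toCircle) z
      have h2 : (fourier (k : ℤ) θ : ℂ) = (θ.toCircle : ℂ) ^ k := by
        rw [fourier_apply, AddCircle.toCircle_zsmul]; simp
      rw [h2]
      linear_combination (-b k) * this
  have hcirc : Continuous fun θ : AddCircle (1 : ℝ) => (θ.toCircle : ℂ) :=
    continuous_subtype_val.comp AddCircle.continuous_toCircle
  -- The circle has total mass one and `fockSq` is rotation invariant, so it may be averaged over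
  -- rotations; Tonelli then reduces to Parseval on each circle.
  calc fockSq G = ∫⁻ _ : AddCircle (1 : ℝ), fockSq G ∂AddCircle.haarAddCircle := by simp
    _ = ∫⁻ θ : AddCircle (1 : ℝ), (∫⁻ z : ℂ,
        ENNReal.ofReal (‖G (θ.toCircle * z)‖ ^ 2 * gaussWeight z))
        ∂AddCircle.haarAddCircle :=
      lintegral_congr fun θ => (fockSq_rotate G θ.toCircle).symm
    _ = ∫⁻ z : ℂ, ∫⁻ θ : AddCircle (1 : ℝ),
        ENNReal.ofReal (‖G (θ.toCircle * z)‖ ^ 2 * gaussWeight z)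
        ∂AddCircle.haarAddCircle := by
      refine lintegral_lintegral_swap (Continuous.aemeasurable ?_)
      refine ENNReal.continuous_ofReal.comp (((hG.comp ?_).norm.pow 2).mul
        (continuous_gaussWeight.comp continuous_snd))
      exact (hcirc.comp continuous_fst).mul continuous_snd
    _ = ∫⁻ z : ℂ, ∑' k, ENNReal.ofReal (‖b k‖ ^ 2) *
        ENNReal.ofReal (‖creation n (divMonomial k) z‖ ^ 2 * gaussWeight z) := by
      refine lintegral_congr fun z => ?_
      simp_rw [ENNReal.ofReal_mul (sq_nonneg _)]
      rw [lintegral_mul_const' _ _ ENNReal.ofReal_ne_top, key, ← ENNReal.tsum_mul_right]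
      refine tsum_congr fun k => ?_
      rw [norm_mul, mul_pow, ENNReal.ofReal_mul (sq_nonneg _), mul_assoc]
    _ = _ := by
      have hm : ∀ k, Continuous fun z =>
          ENNReal.ofReal (‖creation n (divMonomial k) z‖ ^ 2 * gaussWeight z) := fun k =>
        ENNReal.continuous_ofReal.comp
          (((polyGrowth_creation n k).1.norm.pow 2).mul continuous_gaussWeight)
      rw [lintegral_tsum fun k => ((hm k).measurable.const_mul _).aemeasurable]
      exact tsum_congr fun k => lintegral_const_mul' _ _ ENNReal.ofReal_ne_top

/-- Both sides are Parseval sums with the same Taylor coefficients, and the ratio of the squared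
norms of corresponding terms is independent of k. -/
lemma fockSq_creation (n : ℕ) {g : ℂ → ℂ} (hg : Differentiable ℂ g) :
    fockSq (creation n g) = ENNReal.ofReal ((2 * Real.pi) ^ n * n.factorial) * fockSq g := by
  have h0 := fockSq_hasSum 0 hg.continuous (hasSum_creation 0 hg)
  rw [fockSq_hasSum n (continuous_creation n hg) (hasSum_creation n hg), h0,
    ← ENNReal.tsum_mul_left]
  refine tsum_congr fun k => ?_
  rw [fockSq_creation_divMonomial, fockSq_creation_divMonomial 0]
  simp
  ring

/-! ### The complex Bargmann transform: holomorphy and symmetry -/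

/-- The complex Bargmann kernel. -/
noncomputable def scalarKernel (z : ℂ) (t : ℝ) : ℂ :=
  ((2 : ℝ) ^ (3 / 4 : ℝ) : ℝ) *
    Complex.exp (-Real.pi * t ^ 2 + 2 * Real.pi * Real.sqrt 2 * z * t + -Real.pi * z ^ 2)

lemma scalarKernel_conj (z : ℂ) (t : ℝ) : scalarKernel (conj z) t = conj (scalarKernel z t) := by
  rw [scalarKernel, scalarKernel, map_mul, ← Complex.exp_conj]
  simp [map_ofNat]

lemma memLp_cexp_quadratic (c d : ℂ) :
    MemLp (fun t : ℝ => Complex.exp (-Real.pi * t ^ 2 + c * t + d)) 2 := by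
  have hc : Continuous fun t : ℝ => Complex.exp (-Real.pi * t ^ 2 + c * t + d) := by fun_prop
  rw [memLp_two_iff_integrable_sq_norm hc.aestronglyMeasurable]
  have := (integrable_cexp_quadratic' (b := -(2 * Real.pi))
    (by simp [Real.pi_pos]) (2 * c) (2 * d)).norm
  refine this.congr (Filter.Eventually.of_forall fun t => ?_)
  simp only
  rw [← norm_pow, ← Complex.exp_nat_mul]
  congr 2
  push_cast
  ring

lemma memLp_scalarKernel (z : ℂ) : MemLp (scalarKernel z) 2 :=
  (memLp_cexp_quadratic _ _).const_mul _

lemma memLp_conj_scalarKernel (z : ℂ) : MemLp (fun t => conj (scalarKernel z t)) 2 := by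
  simp_rw [← scalarKernel_conj]
  exact memLp_scalarKernel _

/-- The complex Bargmann transform. -/
noncomputable def scalarBargmann (φ : ℝ → ℂ) (z : ℂ) : ℂ := ∫ t, scalarKernel z t * φ t

lemma integrable_scalarKernel_mul (z : ℂ) {φ : ℝ → ℂ} (hφ : MemLp φ 2) :
    Integrable fun t => scalarKernel z t * φ t :=
  (memLp_scalarKernel z).integrable_mul hφ

/-- The evaluation of the complex Bargmann transform at a point. -/
noncomputable def scalarBargmannCLM (z : ℂ) : Lp ℂ 2 (volume : Measure ℝ) →L[ℂ] ℂ :=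
  innerSL ℂ (memLp_conj_scalarKernel z).toLp

lemma scalarBargmannCLM_apply (z : ℂ) (φ : Lp ℂ 2 (volume : Measure ℝ)) :
    scalarBargmannCLM z φ = scalarBargmann φ z := by
  rw [scalarBargmannCLM, innerSL_apply_apply, L2.inner_def]
  refine integral_congr_ae ?_
  filter_upwards [(memLp_conj_scalarKernel z).coeFn_toLp] with t ht
  rw [ht]
  simp [mul_comm]

lemma scalarBargmann_congr {φ ψ : ℝ → ℂ} (h : φ =ᵐ[volume] ψ) :
    scalarBargmann φ = scalarBargmann ψ := by
  ext z
  refine integral_congr_ae ?_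
  filter_upwards [h] with t ht
  rw [ht]

lemma exp_mul_abs_le (a t : ℝ) :
    Real.exp (a * |t|) ≤ Real.exp (a * t) + Real.exp (-a * t) := by
  rcases abs_cases t with h | h <;> rw [h.1]
  · linarith [Real.exp_pos (-a * t)]
  · rw [mul_neg, ← neg_mul]; linarith [Real.exp_pos (a * t)]

lemma integrable_exp_abs_mul_gaussian (a : ℝ) {φ : ℝ → ℂ} (hφ : MemLp φ 2) :
    Integrable fun t : ℝ => Real.exp (a * |t|) * (Real.exp (-Real.pi * t ^ 2) * ‖φ t‖) := by
  have h : ∀ b : ℝ, Integrable fun t : ℝ =>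
      Real.exp (b * t) * (Real.exp (-Real.pi * t ^ 2) * ‖φ t‖) := fun b => by
    refine ((memLp_cexp_quadratic b 0).integrable_mul hφ).norm.congr
      (Filter.Eventually.of_forall fun t => ?_)
    simp only [Pi.mul_apply, norm_mul, Complex.norm_exp]
    rw [← mul_assoc, ← Real.exp_add]
    congr 2
    simp [← Complex.ofReal_pow]
    ring
  refine ((h a).add (h (-a))).mono' ?_ (Filter.Eventually.of_forall fun t => ?_)
  · have h1 : Continuous fun t : ℝ => Real.exp (a * |t|) := by fun_prop
    have h2 : Continuous fun t : ℝ => Real.exp (-Real.pi * t ^ 2) := by fun_prop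
    exact h1.aestronglyMeasurable.mul (h2.aestronglyMeasurable.mul hφ.1.norm)
  · rw [Real.norm_of_nonneg (by positivity)]
    simp only [Pi.add_apply]
    rw [← add_mul]
    gcongr
    exact exp_mul_abs_le a t

/-- Once e^{−πz²} is taken out, a Laplace-type integral remains, which is differentiated under the
integral sign. -/
lemma differentiable_scalarBargmann {φ : ℝ → ℂ} (hφ : MemLp φ 2) :
    Differentiable ℂ (scalarBargmann φ) := by
  set s : ℝ := 2 * Real.pi * Real.sqrt 2 with hs
  have hs0 : 0 ≤ s := by positivity
  have hE : Differentiable ℂ fun z : ℂ => ∫ t : ℝ, Complex.exp (s * z * t) *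
      (Complex.exp (-Real.pi * t ^ 2) * φ t) := by
    intro z₀
    have hφm : AEStronglyMeasurable (fun t : ℝ => Complex.exp (-Real.pi * t ^ 2) * φ t) := by
      have : Continuous fun t : ℝ => Complex.exp (-Real.pi * t ^ 2) := by fun_prop
      exact this.aestronglyMeasurable.mul hφ.1
    have hm : ∀ z : ℂ, AEStronglyMeasurable (fun t : ℝ => Complex.exp (s * z * t) *
        (Complex.exp (-Real.pi * t ^ 2) * φ t)) := fun z => by
      have : Continuous fun t : ℝ => Complex.exp (s * z * t) := by fun_prop
      exact this.aestronglyMeasurable.mul hφm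
    have hg : ∀ t : ℝ, ‖Complex.exp (-Real.pi * t ^ 2)‖ = Real.exp (-Real.pi * t ^ 2) := by
      intro t; rw [Complex.norm_exp]; simp [← Complex.ofReal_pow]
    have hk : ∀ (z : ℂ) (t : ℝ), ‖Complex.exp (s * z * t)‖ ≤ Real.exp (s * ‖z‖ * |t|) := by
      intro z t
      refine (Complex.norm_exp_le_exp_norm _).trans_eq ?_
      rw [norm_mul, norm_mul, Complex.norm_real, Complex.norm_real, Real.norm_eq_abs,
        Real.norm_eq_abs, abs_of_nonneg hs0]
    -- In `‖z₀‖ + 2` one unit is the radius of the ball, the other pays for the factor s|t| ≤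
    -- e^{s|t|} of the derivative.
    refine (hasDerivAt_integral_of_dominated_loc_of_deriv_le (𝕜 := ℂ)
      (s := Metric.ball z₀ 1) (bound := fun t => Real.exp (s * (‖z₀‖ + 2) * |t|) *
        (Real.exp (-Real.pi * t ^ 2) * ‖φ t‖))
      (F' := fun z t => s * t * Complex.exp (s * z * t) *
        (Complex.exp (-Real.pi * t ^ 2) * φ t)) (Metric.ball_mem_nhds z₀ one_pos)
      (Filter.Eventually.of_forall hm) ?_ ?_ ?_
      (integrable_exp_abs_mul_gaussian _ hφ) ?_).2.differentiableAt
    · refine (integrable_exp_abs_mul_gaussian (s * ‖z₀‖) hφ).mono' (hm z₀)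
        (Filter.Eventually.of_forall fun t => ?_)
      rw [norm_mul, norm_mul, hg]
      gcongr
      exact hk z₀ t
    · have : Continuous fun t : ℝ => s * t * Complex.exp (s * z₀ * t) := by fun_prop
      exact this.aestronglyMeasurable.mul hφm
    · refine Filter.Eventually.of_forall fun t z hz => ?_
      have hz' : ‖z‖ ≤ ‖z₀‖ + 1 := by
        have h1 : ‖z - z₀‖ < 1 := by simpa [dist_eq_norm] using hz
        have h2 := norm_sub_norm_le z z₀
        linarith
      rw [norm_mul, norm_mul, norm_mul, norm_mul, hg, Complex.norm_real, Complex.norm_real,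
        Real.norm_eq_abs, Real.norm_eq_abs, abs_of_nonneg hs0]
      gcongr
      have h1 : s * |t| ≤ Real.exp (s * |t|) := by linarith [Real.add_one_le_exp (s * |t|)]
      calc s * |t| * ‖Complex.exp (s * z * t)‖
          ≤ Real.exp (s * |t|) * Real.exp (s * (‖z₀‖ + 1) * |t|) := by
            gcongr
            exact (hk z t).trans (by gcongr)
        _ = Real.exp (s * (‖z₀‖ + 2) * |t|) := by rw [← Real.exp_add]; ring_nf
    · refine Filter.Eventually.of_forall fun t z _ => ?_
      refine HasDerivAt.mul_const ?_ _
      have := ((((hasDerivAt_id z).const_mul (s : ℂ)).mul_const (t : ℂ))).cexp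
      simpa [mul_comm, mul_left_comm] using this
  have : scalarBargmann φ = fun z => ((2 : ℝ) ^ (3 / 4 : ℝ) : ℝ) * Complex.exp (-Real.pi * z ^ 2) *
      ∫ t : ℝ, Complex.exp (s * z * t) * (Complex.exp (-Real.pi * t ^ 2) * φ t) := by
    ext z
    rw [scalarBargmann, ← integral_const_mul]
    refine integral_congr_ae (Filter.Eventually.of_forall fun t => ?_)
    simp only [scalarKernel, hs, Complex.exp_add]
    push_cast
    ring
  rw [this]
  exact (by fun_prop : Differentiable ℂ fun z : ℂ =>
    (((2 : ℝ) ^ (3 / 4 : ℝ) : ℝ) : ℂ) * Complex.exp (-Real.pi * z ^ 2)).mul hE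

/-- The Bargmann transforms of real functions are intrinsic. -/
lemma scalarBargmann_ofReal_conj (φ : ℝ → ℝ) (z : ℂ) :
    scalarBargmann (fun t => (φ t : ℂ)) (conj z) = conj (scalarBargmann (fun t => (φ t : ℂ)) z) := by
  rw [scalarBargmann, scalarBargmann, ← integral_conj]
  simp_rw [scalarKernel_conj, map_mul, Complex.conj_ofReal]

/-- Under this symmetry conj φ has the same transform as φ, hence so has their mean Re φ. This will
make preimages real. -/
lemma scalarBargmann_re {φ : ℝ → ℂ} (hφ : MemLp φ 2)
    (h : ∀ z, scalarBargmann φ (conj z) = conj (scalarBargmann φ z)) :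
    scalarBargmann (fun t => ((φ t).re : ℂ)) = scalarBargmann φ := by
  ext z
  have h1 : ∫ t, scalarKernel z t * conj (φ t) = scalarBargmann φ z := by
    rw [← Complex.conj_conj (scalarBargmann φ z), ← h, scalarBargmann, ← integral_conj]
    simp_rw [scalarKernel_conj, map_mul, Complex.conj_conj]
  have hi := integrable_scalarKernel_mul z hφ
  have hi' : Integrable fun t => scalarKernel z t * conj (φ t) :=
    integrable_scalarKernel_mul z hφ.star
  calc scalarBargmann (fun t => ((φ t).re : ℂ)) z
      = ∫ t, (1 / 2 : ℂ) * (scalarKernel z t * φ t + scalarKernel z t * conj (φ t)) := by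
        refine integral_congr_ae (Filter.Eventually.of_forall fun t => ?_)
        simp only
        rw [Complex.re_eq_add_conj]
        ring
    _ = scalarBargmann φ z := by
        rw [integral_const_mul, integral_add hi hi', h1, scalarBargmann]
        ring

/-! ### Isometry of the complex Bargmann transform -/

section

open scoped FourierTransform ContDiff

/-- The Fourier-type representation of the complex Bargmann transform along a vertical line. -/
lemma scalarBargmann_eq_fourier {φ : ℝ → ℂ} {x : ℝ} {f : SchwartzMap ℝ ℂ}
    (hf : ∀ t : ℝ, f t = Complex.exp (-Real.pi * t ^ 2 + 2 * Real.pi * Real.sqrt 2 * x * t) * φ t)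
    (y : ℝ) :
    scalarBargmann φ ⟨x, y⟩ = ((2 : ℝ) ^ (3 / 4 : ℝ) : ℝ) *
      Complex.exp (-Real.pi * (⟨x, y⟩ : ℂ) ^ 2) * 𝓕 f (-Real.sqrt 2 * y) := by
  rw [SchwartzMap.fourier_coe, Real.fourier_real_eq_integral_exp_smul, scalarBargmann,
    ← integral_const_mul]
  refine integral_congr_ae (Filter.Eventually.of_forall fun t => ?_)
  have key : Complex.exp (-Real.pi * t ^ 2 + 2 * Real.pi * Real.sqrt 2 * (⟨x, y⟩ : ℂ) * t +
      -Real.pi * (⟨x, y⟩ : ℂ) ^ 2) = Complex.exp (-Real.pi * (⟨x, y⟩ : ℂ) ^ 2) *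
      Complex.exp (↑(-2 * Real.pi * t * (-Real.sqrt 2 * y)) * Complex.I) *
      Complex.exp (-Real.pi * t ^ 2 + 2 * Real.pi * Real.sqrt 2 * x * t) := by
    rw [← Complex.exp_add, ← Complex.exp_add, Complex.mk_eq_add_mul_I]
    congr 1
    push_cast
    ring
  simp only [scalarKernel, hf, smul_eq_mul]
  rw [key]
  ring

/-- Plancherel in y: the Fourier transform is that of φ times a Gaussian-exponential factor. The
dependence on y of |e^{−πz²}|² cancels against the weight, leaving e^{−4πx²}; with the factor in t
this completes the square. -/
lemma lintegral_scalarBargmann_line {φ : ℝ → ℂ} (hφ : HasCompactSupport φ) (hφ' : ContDiff ℝ ∞ φ)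
    (x : ℝ) :
    ∫⁻ y : ℝ, ENNReal.ofReal (‖scalarBargmann φ ⟨x, y⟩‖ ^ 2 * gaussWeight ⟨x, y⟩) =
      ∫⁻ t : ℝ, ENNReal.ofReal (‖φ t‖ ^ 2) *
        ENNReal.ofReal (2 * Real.exp (-(4 * Real.pi) * (x - t / Real.sqrt 2) ^ 2)) := by
  have hsm : ContDiff ℝ ∞ fun t : ℝ =>
      Complex.exp (-Real.pi * t ^ 2 + 2 * Real.pi * Real.sqrt 2 * x * t) * φ t := by
    have h0 : ContDiff ℝ ∞ fun t : ℝ => (t : ℂ) := Complex.ofRealCLM.contDiff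
    refine ContDiff.mul (ContDiff.cexp ?_) hφ'
    exact (contDiff_const.mul (h0.pow 2)).add (contDiff_const.mul h0)
  have hcs : HasCompactSupport fun t : ℝ =>
      Complex.exp (-Real.pi * t ^ 2 + 2 * Real.pi * Real.sqrt 2 * x * t) * φ t := hφ.mul_left
  set f : SchwartzMap ℝ ℂ := hcs.toSchwartzMap hsm with hfdef
  have hf : ∀ t : ℝ, f t =
    Complex.exp (-Real.pi * t ^ 2 + 2 * Real.pi * Real.sqrt 2 * x * t) * φ t := fun t => rfl
  have hs2 : (0 : ℝ) < Real.sqrt 2 := by positivity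
  have hss : Real.sqrt 2 * Real.sqrt 2 = 2 := Real.mul_self_sqrt (by norm_num)
  have hc : ((2 : ℝ) ^ (3 / 4 : ℝ)) ^ 2 = 2 * Real.sqrt 2 := by
    rw [← Real.rpow_natCast, ← Real.rpow_mul (by norm_num), Real.sqrt_eq_rpow]
    nth_rewrite 2 [← Real.rpow_one 2]
    rw [← Real.rpow_add (by norm_num)]
    norm_num
  have h1 : ∀ y : ℝ, ‖scalarBargmann φ ⟨x, y⟩‖ ^ 2 * gaussWeight ⟨x, y⟩ =
      2 * Real.sqrt 2 * Real.exp (-(4 * Real.pi) * x ^ 2) * ‖𝓕 f (-Real.sqrt 2 * y)‖ ^ 2 := by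
    intro y
    rw [scalarBargmann_eq_fourier hf, norm_mul, norm_mul, Complex.norm_real,
      Real.norm_of_nonneg (by positivity), mul_pow, mul_pow, hc, Complex.norm_exp,
      ← Real.exp_nat_mul, gaussWeight, ← Complex.normSq_eq_norm_sq ⟨x, y⟩]
    have : -(4 * Real.pi) * x ^ 2 = ((2 : ℕ) : ℝ) * (-Real.pi * (⟨x, y⟩ : ℂ) ^ 2).re +
        -(2 * Real.pi) * Complex.normSq ⟨x, y⟩ := by
      simp [Complex.normSq_apply, pow_two]
      ring
    rw [this, Real.exp_add]
    ring
  have hint : Integrable fun ξ => ‖𝓕 f ξ‖ ^ 2 := by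
    have := ((𝓕 f).memLp 2 (μ := volume)).1
    exact (memLp_two_iff_integrable_sq_norm this).1 ((𝓕 f).memLp 2)
  have hint2 : Integrable fun t => ‖f t‖ ^ 2 :=
    (memLp_two_iff_integrable_sq_norm (f.memLp 2 (μ := volume)).1).1 (f.memLp 2)
  -- The substitution ξ = −√2 y gives a factor 1/√2, reducing the squared kernel constant 2√2 to 2.
  have h2 : ∫ y : ℝ, ‖𝓕 f (-Real.sqrt 2 * y)‖ ^ 2 = (Real.sqrt 2)⁻¹ * ∫ t, ‖f t‖ ^ 2 := by
    rw [Measure.integral_comp_mul_left (fun ξ => ‖𝓕 f ξ‖ ^ 2),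
      SchwartzMap.integral_norm_sq_fourier]
    simp [abs_of_pos hs2]
  have h3 : ∀ t, 2 * Real.sqrt 2 * Real.exp (-(4 * Real.pi) * x ^ 2) * ((Real.sqrt 2)⁻¹ *
      ‖f t‖ ^ 2) = ‖φ t‖ ^ 2 * (2 * Real.exp (-(4 * Real.pi) * (x - t / Real.sqrt 2) ^ 2)) := by
    intro t
    rw [hf, norm_mul, mul_pow, Complex.norm_exp, ← Real.exp_nat_mul]
    have e1 : -(4 * Real.pi) * (x - t / Real.sqrt 2) ^ 2 = -(4 * Real.pi) * x ^ 2 + ((2 : ℕ) : ℝ) *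
        (-Real.pi * (t : ℂ) ^ 2 + 2 * Real.pi * Real.sqrt 2 * x * t).re := by
      have e2 : t / Real.sqrt 2 = t * Real.sqrt 2 / 2 := by field_simp; linear_combination -t * hss
      have e3 : (-Real.pi * (t : ℂ) ^ 2 + 2 * Real.pi * Real.sqrt 2 * x * t).re =
          -Real.pi * t ^ 2 + 2 * Real.pi * Real.sqrt 2 * x * t := by
        rw [← Complex.ofReal_re (-Real.pi * t ^ 2 + 2 * Real.pi * Real.sqrt 2 * x * t)]
        push_cast
        rfl
      rw [e2, e3]
      push_cast
      linear_combination (-Real.pi * t ^ 2) * hss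
    rw [e1, Real.exp_add]
    field_simp
  simp_rw [h1]
  rw [← ofReal_integral_eq_lintegral_ofReal
    ((hint.comp_mul_left' (by simp)).const_mul _)
    (Filter.Eventually.of_forall fun y => by positivity), integral_const_mul, h2,
    ← integral_const_mul, ← integral_const_mul, ofReal_integral_eq_lintegral_ofReal
    ((hint2.const_mul _).const_mul _) (Filter.Eventually.of_forall fun y => by positivity)]
  refine lintegral_congr fun t => ?_
  rw [h3, ENNReal.ofReal_mul (sq_nonneg _)]

/-- With a = t/√2 this is the integral over x of the factor multiplying |φ(t)|² on vertical lines,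
so summing over the lines gives ∫ |φ|². -/
lemma lintegral_gaussian_translate (a : ℝ) :
    ∫⁻ x : ℝ, ENNReal.ofReal (2 * Real.exp (-(4 * Real.pi) * (x - a) ^ 2)) = 1 := by
  have hi : Integrable fun x : ℝ => 2 * Real.exp (-(4 * Real.pi) * x ^ 2) :=
    (integrable_exp_neg_mul_sq (by positivity)).const_mul _
  have h := integral_sub_right_eq_self (μ := (volume : Measure ℝ))
    (fun x : ℝ => 2 * Real.exp (-(4 * Real.pi) * x ^ 2)) a
  rw [← ofReal_integral_eq_lintegral_ofReal (hi.comp_sub_right a)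
    (Filter.Eventually.of_forall fun y => by positivity), h, integral_const_mul, integral_gaussian]
  have : Real.pi / (4 * Real.pi) = (1 / 2) ^ 2 := by
    field_simp; norm_num
  rw [this, Real.sqrt_sq (by norm_num)]
  norm_num

lemma fockSq_scalarBargmann_of_hasCompactSupport {φ : ℝ → ℂ} (hφ : HasCompactSupport φ)
    (hφ' : ContDiff ℝ ∞ φ) :
    fockSq (scalarBargmann φ) = ∫⁻ t, ENNReal.ofReal (‖φ t‖ ^ 2) := by
  have hmem : MemLp φ 2 := hφ'.continuous.memLp_of_hasCompactSupport hφ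
  have hB := (differentiable_scalarBargmann hmem).continuous
  have hmeas : Measurable fun z =>
      ENNReal.ofReal (‖scalarBargmann φ z‖ ^ 2 * gaussWeight z) :=
    (ENNReal.continuous_ofReal.comp ((hB.norm.pow 2).mul continuous_gaussWeight)).measurable
  have h := Complex.volume_preserving_equiv_real_prod.symm.lintegral_comp hmeas
  rw [fockSq, ← h, Measure.volume_eq_prod, lintegral_prod]
  · calc _ = ∫⁻ x : ℝ, ∫⁻ t : ℝ, ENNReal.ofReal (‖φ t‖ ^ 2) *
        ENNReal.ofReal (2 * Real.exp (-(4 * Real.pi) * (x - t / Real.sqrt 2) ^ 2)) :=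
        lintegral_congr fun x => lintegral_scalarBargmann_line hφ hφ' x
      _ = ∫⁻ t : ℝ, ∫⁻ x : ℝ, ENNReal.ofReal (‖φ t‖ ^ 2) *
        ENNReal.ofReal (2 * Real.exp (-(4 * Real.pi) * (x - t / Real.sqrt 2) ^ 2)) := by
        refine lintegral_lintegral_swap (Measurable.aemeasurable ?_)
        have := hφ'.continuous.measurable
        fun_prop
      _ = _ := by
        refine lintegral_congr fun t => ?_
        rw [lintegral_const_mul' _ _ ENNReal.ofReal_ne_top, lintegral_gaussian_translate, mul_one]
  · exact (hmeas.comp Complex.measurableEquivRealProd.symm.measurable).aemeasurable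

/-- The Bargmann transform multiplied by the square root of the weight. -/
noncomputable def weightedBargmann (φ : ℝ → ℂ) (z : ℂ) : ℂ :=
  Real.sqrt (gaussWeight z) * scalarBargmann φ z

lemma lintegral_enorm_sq_sqrt_gaussWeight_mul (g : ℂ → ℂ) :
    ∫⁻ z, ‖(Real.sqrt (gaussWeight z) : ℂ) * g z‖ₑ ^ (2 : ℝ) = fockSq g := by
  refine lintegral_congr fun z => ?_
  rw [← ofReal_norm, ENNReal.ofReal_rpow_of_nonneg (norm_nonneg _) (by norm_num),
    norm_mul, Complex.norm_real, Real.norm_of_nonneg (Real.sqrt_nonneg _)]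
  norm_cast
  rw [mul_pow, Real.sq_sqrt (gaussWeight_pos z).le, mul_comm]

lemma eLpNorm_weightedBargmann_sq (φ : ℝ → ℂ) :
    eLpNorm (weightedBargmann φ) 2 ^ (2 : ℝ) = fockSq (scalarBargmann φ) := by
  rw [← lintegral_enorm_sq_sqrt_gaussWeight_mul,
    eLpNorm_eq_lintegral_rpow_enorm_toReal (by norm_num) (by norm_num), ← ENNReal.rpow_mul]
  simp [weightedBargmann]

lemma lintegral_ofReal_norm_sq (φ : ℝ → ℂ) :
    ∫⁻ t, ENNReal.ofReal (‖φ t‖ ^ 2) = eLpNorm φ 2 ^ (2 : ℝ) := by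
  rw [eLpNorm_eq_lintegral_rpow_enorm_toReal (by norm_num) (by norm_num), ← ENNReal.rpow_mul]
  simp [ENNReal.ofReal_pow]

lemma continuous_weightedBargmann {φ : ℝ → ℂ} (hφ : MemLp φ 2) :
    Continuous (weightedBargmann φ) :=
  (Complex.continuous_ofReal.comp (continuous_gaussWeight.sqrt)).mul
    (differentiable_scalarBargmann hφ).continuous

lemma eLpNorm_weightedBargmann_of_hasCompactSupport {φ : ℝ → ℂ} (hφ : HasCompactSupport φ)
    (hφ' : ContDiff ℝ ∞ φ) : eLpNorm (weightedBargmann φ) 2 = eLpNorm φ 2 := by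
  have h := eLpNorm_weightedBargmann_sq φ
  rw [fockSq_scalarBargmann_of_hasCompactSupport hφ hφ', lintegral_ofReal_norm_sq] at h
  exact ENNReal.rpow_left_injective (by norm_num) h

/-- Smooth compactly supported elements of `L²`. -/
def smoothCompact : Set (Lp ℂ 2 (volume : Measure ℝ)) :=
  {f | ∃ g : ℝ → ℂ, f =ᵐ[volume] g ∧ HasCompactSupport g ∧ ContDiff ℝ ∞ g}

lemma dense_smoothCompact : Dense smoothCompact :=
  Lp.dense_hasCompactSupport_contDiff (by norm_num)

lemma eLpNorm_weightedBargmann_of_mem {φ : Lp ℂ 2 (volume : Measure ℝ)} (h : φ ∈ smoothCompact) :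
    eLpNorm (weightedBargmann φ) 2 = ‖φ‖ₑ := by
  obtain ⟨g, hg, h1, h2⟩ := h
  have : weightedBargmann φ = weightedBargmann g := by
    ext z; rw [weightedBargmann, weightedBargmann, scalarBargmann_congr hg]
  rw [this, eLpNorm_weightedBargmann_of_hasCompactSupport h1 h2, Lp.enorm_def,
    eLpNorm_congr_ae hg]

/-- Fatou along test functions converging in L²; their transforms converge pointwise because
evaluations are continuous. The inequality suffices to define a bounded operator, and equality then
extends by density. -/
lemma eLpNorm_weightedBargmann_le (φ : Lp ℂ 2 (volume : Measure ℝ)) :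
    eLpNorm (weightedBargmann φ) 2 ≤ ‖φ‖ₑ := by
  obtain ⟨u, hu, hlim⟩ := mem_closure_iff_seq_limit.1 (dense_smoothCompact φ)
  have h1 := Lp.eLpNorm_lim_le_liminf_eLpNorm (p := 2) (μ := (volume : Measure ℂ))
    (f := fun n => weightedBargmann (u n))
    (fun n => (continuous_weightedBargmann (Lp.memLp (u n))).aestronglyMeasurable)
    (weightedBargmann φ) (Filter.Eventually.of_forall fun z => by
      simp only [weightedBargmann, ← scalarBargmannCLM_apply]
      exact (((scalarBargmannCLM z).continuous.tendsto φ).comp hlim).const_mul _)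
  refine h1.trans_eq ?_
  simp_rw [eLpNorm_weightedBargmann_of_mem (hu _)]
  exact ((continuous_enorm.tendsto φ).comp hlim).liminf_eq

lemma memLp_weightedBargmann (φ : Lp ℂ 2 (volume : Measure ℝ)) :
    MemLp (weightedBargmann φ) 2 :=
  ⟨(continuous_weightedBargmann (Lp.memLp φ)).aestronglyMeasurable,
    (eLpNorm_weightedBargmann_le φ).trans_lt enorm_lt_top⟩

/-- The Bargmann transform as a bounded operator into `L²(ℂ)`. -/
noncomputable def weightedBargmannCLM :
    Lp ℂ 2 (volume : Measure ℝ) →L[ℂ] Lp ℂ 2 (volume : Measure ℂ) :=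
  LinearMap.mkContinuous
    { toFun := fun φ => (memLp_weightedBargmann φ).toLp
      map_add' := fun φ ψ => by
        rw [← MemLp.toLp_add]
        congr 1
        ext z
        simp only [weightedBargmann, ← scalarBargmannCLM_apply, map_add, Pi.add_apply]
        ring
      map_smul' := fun c φ => by
        rw [RingHom.id_apply, ← MemLp.toLp_const_smul]
        congr 1
        ext z
        simp only [weightedBargmann, ← scalarBargmannCLM_apply, map_smul, Pi.smul_apply,
          smul_eq_mul]
        ring } 1 fun φ => by
    rw [one_mul]
    change ‖(memLp_weightedBargmann φ).toLp‖ ≤ ‖φ‖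
    rw [Lp.norm_toLp, ← toReal_enorm φ]
    exact ENNReal.toReal_mono enorm_ne_top (eLpNorm_weightedBargmann_le φ)

lemma norm_weightedBargmannCLM (φ : Lp ℂ 2 (volume : Measure ℝ)) :
    ‖weightedBargmannCLM φ‖ = ‖φ‖ := by
  refine closure_minimal (s := smoothCompact) (t := {ψ | ‖weightedBargmannCLM ψ‖ = ‖ψ‖})
    (fun ψ hψ => ?_) (isClosed_eq weightedBargmannCLM.continuous.norm continuous_norm)
    (dense_smoothCompact φ)
  change ‖(memLp_weightedBargmann ψ).toLp‖ = ‖ψ‖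
  rw [Lp.norm_toLp, eLpNorm_weightedBargmann_of_mem hψ, toReal_enorm]

/-- The complex Bargmann transform is isometric. -/
lemma fockSq_scalarBargmann (φ : Lp ℂ 2 (volume : Measure ℝ)) :
    fockSq (scalarBargmann φ) = ENNReal.ofReal (‖φ‖ ^ 2) := by
  have h : eLpNorm (weightedBargmann φ) 2 = ‖φ‖ₑ := by
    have h1 := norm_weightedBargmannCLM φ
    change ‖(memLp_weightedBargmann φ).toLp‖ = ‖φ‖ at h1
    rw [Lp.norm_toLp] at h1
    rw [← ofReal_norm, ← h1, ENNReal.ofReal_toReal (memLp_weightedBargmann φ).2.ne]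
  rw [← eLpNorm_weightedBargmann_sq, h, ← ofReal_norm,
    ENNReal.ofReal_rpow_of_nonneg (norm_nonneg _) (by norm_num)]
  norm_cast

end

/-! ### Surjectivity of the complex Bargmann transform -/

/-- The product of a polynomial and the Gaussian `e^{-πt²}`. -/
noncomputable def polyGaussian (p : Polynomial ℂ) (t : ℝ) : ℂ :=
  p.eval (t : ℂ) * Complex.exp (-Real.pi * t ^ 2)

lemma polyGaussian_add (p q : Polynomial ℂ) :
    polyGaussian (p + q) = polyGaussian p + polyGaussian q := by
  ext t; simp [polyGaussian, add_mul]

lemma polyGaussian_C_mul (c : ℂ) (p : Polynomial ℂ) :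
    polyGaussian (Polynomial.C c * p) = c • polyGaussian p := by
  ext t; simp [polyGaussian, mul_assoc]

lemma memLp_polyGaussian (p : Polynomial ℂ) : MemLp (polyGaussian p) 2 := by
  induction p using Polynomial.induction_on' with
  | add p q hp hq => rw [polyGaussian_add]; exact hp.add hq
  | monomial n a =>
    rw [← Polynomial.C_mul_X_pow_eq_monomial, polyGaussian_C_mul]
    refine MemLp.const_smul ?_ a
    have hc : Continuous (polyGaussian (Polynomial.X ^ n)) := by
      unfold polyGaussian; fun_prop
    rw [memLp_two_iff_integrable_sq_norm hc.aestronglyMeasurable]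
    have hn : (-1 : ℝ) < ((2 * n : ℕ) : ℝ) :=
      lt_of_lt_of_le (by norm_num) (Nat.cast_nonneg (2 * n))
    refine (integrable_rpow_mul_exp_neg_mul_sq (b := 2 * Real.pi) (by positivity) hn).congr
      (Filter.Eventually.of_forall fun t => ?_)
    simp only [polyGaussian, Polynomial.eval_pow, Polynomial.eval_X, norm_mul, norm_pow,
      Complex.norm_real, Complex.norm_exp, Real.rpow_natCast, mul_pow, Real.norm_eq_abs]
    rw [← Real.exp_nat_mul, ← pow_mul, mul_comm n 2, pow_mul, pow_mul, sq_abs]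
    congr 2
    simp [← Complex.ofReal_pow]
    ring

lemma hasDerivAt_scalarKernel_mul_polyGaussian (p : Polynomial ℂ) (z : ℂ) (t : ℝ) :
    HasDerivAt (fun t : ℝ => scalarKernel z t * polyGaussian p t)
      (scalarKernel z t * polyGaussian (p.derivative +
        Polynomial.C (-(4 * Real.pi) : ℂ) * (Polynomial.X * p)) t +
        2 * Real.pi * Real.sqrt 2 * z * (scalarKernel z t * polyGaussian p t)) t := by
  have h1 : HasDerivAt (fun w : ℂ => -Real.pi * w ^ 2 + 2 * Real.pi * Real.sqrt 2 * z * w +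
      -Real.pi * z ^ 2) (-Real.pi * (2 * t) + 2 * Real.pi * Real.sqrt 2 * z) (t : ℂ) := by
    simpa using ((((hasDerivAt_pow 2 (t : ℂ)).const_mul (-Real.pi : ℂ)).add
      ((hasDerivAt_id (t : ℂ)).const_mul (2 * Real.pi * Real.sqrt 2 * z : ℂ))).add_const
        (-Real.pi * z ^ 2 : ℂ))
  have h2 : HasDerivAt (fun w : ℂ => -Real.pi * w ^ 2) (-Real.pi * (2 * t)) (t : ℂ) := by
    simpa using ((hasDerivAt_pow 2 (t : ℂ)).const_mul (-Real.pi : ℂ))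
  have h := ((h1.cexp.const_mul (((2 : ℝ) ^ (3 / 4 : ℝ) : ℝ) : ℂ)).mul
    ((p.hasDerivAt (t : ℂ)).mul h2.cexp)).comp_ofReal
  convert! h using 1
  simp [scalarKernel, polyGaussian]
  ring

/-- The t-derivative of the integrand integrates to zero. The Gaussians in the kernel and in
`polyGaussian` contribute −2πt each, and the mixed term of the kernel gives 2π√2 z. -/
lemma scalarBargmann_polyGaussian_raise (p : Polynomial ℂ) (z : ℂ) :
    2 * Real.pi * Real.sqrt 2 * z * scalarBargmann (polyGaussian p) z =
      scalarBargmann (polyGaussian (-(p.derivative +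
        Polynomial.C (-(4 * Real.pi) : ℂ) * (Polynomial.X * p)))) z := by
  have hi : ∀ q, Integrable fun t => scalarKernel z t * polyGaussian q t := fun q =>
    integrable_scalarKernel_mul z (memLp_polyGaussian q)
  have h := integral_eq_zero_of_hasDerivAt_of_integrable
    (fun t => hasDerivAt_scalarKernel_mul_polyGaussian p z t)
    ((hi _).add ((hi p).const_mul _)) (hi p)
  rw [integral_add (hi _) ((hi p).const_mul _), integral_const_mul] at h
  have hneg : ∀ q, polyGaussian (-q) = -polyGaussian q := fun q => by
    ext t; simp [polyGaussian]
  rw [hneg, scalarBargmann, scalarBargmann]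
  simp only [Pi.neg_apply, mul_neg, integral_neg]
  linear_combination h

lemma scalarBargmann_const_smul (c : ℂ) (φ : ℝ → ℂ) (z : ℂ) :
    scalarBargmann (c • φ) z = c * scalarBargmann φ z := by
  rw [scalarBargmann, scalarBargmann, ← integral_const_mul]
  refine integral_congr_ae (Filter.Eventually.of_forall fun t => ?_)
  simp only [Pi.smul_apply, smul_eq_mul]
  ring

/-- The total exponent is the perfect square −2π (t − z/√2)², so the integral does not depend on z.
-/
lemma scalarBargmann_gaussian :
    ∃ c : ℂ, c ≠ 0 ∧ ∀ z, scalarBargmann (polyGaussian 1) z = c := by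
  refine ⟨((2 : ℝ) ^ (3 / 4 : ℝ) : ℝ) * (Real.pi / -(-(2 * Real.pi) : ℂ)) ^ (1 / 2 : ℂ), ?_,
    fun z => ?_⟩
  · refine mul_ne_zero ?_ ?_
    · exact_mod_cast (Real.rpow_pos_of_pos two_pos _).ne'
    · rw [Ne, Complex.cpow_eq_zero_iff]
      have : (Real.pi : ℂ) ≠ 0 := by exact_mod_cast Real.pi_ne_zero
      simp [this]
  · have h : ∀ t : ℝ, scalarKernel z t * polyGaussian 1 t = ((2 : ℝ) ^ (3 / 4 : ℝ) : ℝ) *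
        Complex.exp (-(2 * Real.pi) * t ^ 2 + (2 * Real.pi * Real.sqrt 2 * z) * t +
          -Real.pi * z ^ 2) := by
      intro t
      simp only [scalarKernel, polyGaussian, Polynomial.eval_one, one_mul]
      rw [mul_assoc, ← Complex.exp_add]
      congr 2
      ring
    have hπ : (Real.pi : ℂ) ≠ 0 := by exact_mod_cast Real.pi_ne_zero
    have hss : (Real.sqrt 2 : ℂ) ^ 2 = 2 := by
      exact_mod_cast Real.sq_sqrt (by norm_num : (0 : ℝ) ≤ 2)
    have he : -Real.pi * z ^ 2 - (2 * Real.pi * Real.sqrt 2 * z) ^ 2 / (4 * (-(2 * Real.pi))) =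
        (0 : ℂ) := by
      field_simp
      linear_combination (2 * Real.pi * z ^ 2) * hss
    simp_rw [scalarBargmann, h]
    rw [integral_const_mul, integral_cexp_quadratic (by simp [Real.pi_pos]), he]
    simp

lemma exists_polyGaussian_eq_divMonomial (k : ℕ) :
    ∃ p : Polynomial ℂ, ∀ z, scalarBargmann (polyGaussian p) z = divMonomial k z := by
  induction k with
  | zero =>
    obtain ⟨c, hc, h⟩ := scalarBargmann_gaussian
    refine ⟨Polynomial.C c⁻¹ * 1, fun z => ?_⟩
    rw [polyGaussian_C_mul, scalarBargmann_const_smul, h]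
    simp [divMonomial, hc]
  | succ k ih =>
    obtain ⟨p, hp⟩ := ih
    have hs : (2 * Real.pi * Real.sqrt 2 : ℂ) ≠ 0 := by
      have : (2 * Real.pi * Real.sqrt 2 : ℝ) ≠ 0 := by positivity
      exact_mod_cast this
    refine ⟨Polynomial.C ((2 * Real.pi * Real.sqrt 2 * (k + 1) : ℂ)⁻¹) *
      -(p.derivative + Polynomial.C (-(4 * Real.pi) : ℂ) * (Polynomial.X * p)), fun z => ?_⟩
    rw [polyGaussian_C_mul, scalarBargmann_const_smul, ← scalarBargmann_polyGaussian_raise, hp,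
      divMonomial, divMonomial, Nat.factorial_succ]
    have h1 : ((k : ℂ) + 1) ≠ 0 := by exact_mod_cast k.succ_ne_zero
    have h2 : (k.factorial : ℂ) ≠ 0 := by exact_mod_cast k.factorial_ne_zero
    push_cast
    field_simp
    ring

/-- The complex Bargmann transform is onto the Fock space. -/
lemma exists_scalarBargmann_eq {g : ℂ → ℂ} (hg : Differentiable ℂ g) (h : fockSq g < ∞) :
    ∃ φ : Lp ℂ 2 (volume : Measure ℝ), scalarBargmann φ = g := by
  choose p hp using exists_polyGaussian_eq_divMonomial
  set ψ : ℕ → Lp ℂ 2 (volume : Measure ℝ) := fun k => (memLp_polyGaussian (p k)).toLp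
  have hψ : ∀ k z, scalarBargmannCLM z (ψ k) = divMonomial k z := fun k z => by
    rw [scalarBargmannCLM_apply, scalarBargmann_congr (memLp_polyGaussian (p k)).coeFn_toLp, hp]
  set b : ℕ → ℂ := fun k => iteratedDeriv k g 0
  set a : ℕ → ℝ≥0∞ := fun k => ENNReal.ofReal (‖b k‖ ^ 2) * fockSq (divMonomial k)
  have ha : ∑' k, a k ≠ ∞ := by
    have h1 := fockSq_hasSum 0 hg.continuous (hasSum_creation 0 hg)
    exact fun h2 => h.ne (h1.trans h2)
  -- By isometry the L² norm of a partial sum is the Fock norm of a Taylor polynomial, which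
  -- Parseval computes with coefficients set to zero outside `s`. Finiteness of `∑' k, a k` then
  -- gives the Cauchy criterion.
  have hnorm : ∀ s : Finset ℕ, ‖∑ k ∈ s, b k • ψ k‖ ^ 2 = ∑ k ∈ s, (a k).toReal := by
    intro s
    have hB : scalarBargmann (∑ k ∈ s, b k • ψ k : Lp ℂ 2 (volume : Measure ℝ)) =
        fun z => ∑ k ∈ s, b k * divMonomial k z := by
      ext z
      rw [← scalarBargmannCLM_apply, map_sum]
      simp [hψ]
    have hc : Continuous fun z => ∑ k ∈ s, b k * divMonomial k z :=
      continuous_finsetSum _ fun k _ => continuous_const.mul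
        (differentiable_divMonomial k).continuous
    have h1 := fockSq_scalarBargmann (∑ k ∈ s, b k • ψ k)
    rw [hB, fockSq_hasSum 0 (b := fun k => if k ∈ s then b k else 0) hc (fun z => ?_), tsum_eq_sum (s := s)] at h1
    · have h2 : ∑ k ∈ s, a k = ENNReal.ofReal (‖∑ k ∈ s, b k • ψ k‖ ^ 2) := by
        rw [← h1]
        exact Finset.sum_congr rfl fun k hk => by simp [hk, a, creation]
      rw [← ENNReal.toReal_sum, h2, ENNReal.toReal_ofReal (sq_nonneg _)]
      exact fun k _ => ENNReal.mul_ne_top ENNReal.ofReal_ne_top (fockSq_divMonomial_lt_top k).ne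
    · intro k hk; simp [hk]
    · have h2 : ∑ k ∈ s, b k * divMonomial k z =
          ∑ k ∈ s, (if k ∈ s then b k else 0) * creation 0 (divMonomial k) z :=
        Finset.sum_congr rfl fun k hk => by rw [if_pos hk]; rfl
      rw [h2]
      exact hasSum_sum_of_ne_finset_zero fun k hk => by simp [hk]
  have hsum : Summable fun k => b k • ψ k := by
    rw [summable_iff_vanishing_norm]
    intro ε hε
    obtain ⟨s, hs⟩ := summable_iff_vanishing_norm.1 (ENNReal.summable_toReal ha) (ε ^ 2)
      (by positivity)
    refine ⟨s, fun t ht => ?_⟩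
    have h1 := (le_abs_self _).trans_lt (hs t ht)
    rw [← hnorm] at h1
    exact lt_of_pow_lt_pow_left₀ 2 hε.le h1
  obtain ⟨φ, hφ⟩ := hsum
  refine ⟨φ, funext fun z => ?_⟩
  -- Continuous evaluation at z turns the L² series into the Taylor series of `g`.
  have h1 := hφ.mapL (scalarBargmannCLM z)
  simp only [map_smul, hψ, scalarBargmannCLM_apply, smul_eq_mul] at h1
  exact h1.unique (hasSum_creation 0 hg z)

/-! ### Imaginary units and slices -/

/-- Multiplicativity of the norm gives |I| = 1, so I² = −|I|², which characterizes a vanishing real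
part. -/
lemma imagUnits_re {I : ℍ[ℝ]} (hI : I ∈ imagUnits) : I.re = 0 := by
  have h : I ^ 2 = -1 := hI
  have hn : Quaternion.normSq I = 1 := by
    have h1 : Quaternion.normSq I ^ 2 = 1 := by
      rw [← map_pow, h]; simp [Quaternion.normSq_neg]
    nlinarith [Quaternion.normSq_nonneg (a := I)]
  rw [← Quaternion.sq_eq_neg_normSq, h, hn]
  simp

lemma imagUnits_norm {I : ℍ[ℝ]} (hI : I ∈ imagUnits) : ‖I‖ = 1 := by
  have h : I ^ 2 = -1 := hI
  have h1 : ‖I‖ ^ 2 = 1 := by rw [← norm_pow, h]; simp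
  nlinarith [norm_nonneg I]

lemma imagUnits_mul_self {I : ℍ[ℝ]} (hI : I ∈ imagUnits) : I * I = -1 := by
  rw [← pow_two]; exact hI

lemma neg_mem_imagUnits {I : ℍ[ℝ]} (hI : I ∈ imagUnits) : -I ∈ imagUnits := by
  have h : I ^ 2 = -1 := hI
  simpa [imagUnits] using h

lemma quatI_mem_imagUnits : quatI ∈ imagUnits := by
  have h0 : quatI.re = 0 := rfl
  have h1 : quatI.imI = 1 := rfl
  have h2 : quatI.imJ = 0 := rfl
  have h3 : quatI.imK = 0 := rfl
  change quatI ^ 2 = -1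
  rw [pow_two]
  ext <;> simp [h0, h1, h2, h3]

lemma sliceUnit_mem_imagUnits (q : ℍ[ℝ]) : sliceUnit q ∈ imagUnits := by
  unfold sliceUnit
  split_ifs with h
  · exact quatI_mem_imagUnits
  · have h1 : q.im ^ 2 = -((Quaternion.normSq q.im : ℝ) : ℍ[ℝ]) := by
      rw [Quaternion.sq_eq_neg_normSq]; simp
    have h2 : ‖q.im‖ ≠ 0 := norm_ne_zero_iff.2 h
    change (‖q.im‖⁻¹ • q.im) ^ 2 = -1
    rw [smul_pow, h1, Quaternion.normSq_eq_norm_mul_self]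
    ext <;> simp
    field_simp

lemma toSlice_sliceUnit (q : ℍ[ℝ]) : toSlice (sliceUnit q) ⟨q.re, ‖q.im‖⟩ = q := by
  unfold toSlice sliceUnit
  split_ifs with h
  · have h1 := Quaternion.re_add_im q
    rw [h] at h1 ⊢
    simpa using h1
  · have h2 : ‖q.im‖ ≠ 0 := norm_ne_zero_iff.2 h
    conv_rhs => rw [← Quaternion.re_add_im q]
    ext <;> simp <;> field_simp

lemma toSlice_re {I : ℍ[ℝ]} (hI : I ∈ imagUnits) (z : ℂ) : (toSlice I z).re = z.re := by
  simp [toSlice, imagUnits_re hI]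

lemma norm_toSlice {I : ℍ[ℝ]} (hI : I ∈ imagUnits) (z : ℂ) : ‖toSlice I z‖ = ‖z‖ := by
  have h1 : Quaternion.normSq I = 1 := by
    rw [Quaternion.normSq_eq_norm_mul_self, imagUnits_norm hI]; simp
  have h2 : Quaternion.normSq (toSlice I z) = Complex.normSq z := by
    have h0 := imagUnits_re hI
    rw [Quaternion.normSq_def', h0] at h1
    rw [Quaternion.normSq_def', Complex.normSq_apply]
    simp [toSlice, h0]
    linear_combination z.im ^ 2 * h1
  rw [Quaternion.normSq_eq_norm_mul_self, Complex.normSq_eq_norm_sq] at h2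
  exact (sq_eq_sq₀ (norm_nonneg _) (norm_nonneg _)).1 (by rw [← h2]; ring)

/-! ### Slice functions through four complex components -/

/-- The quaternion whose components are the real parts of the given complex numbers. -/
noncomputable def reQuat : (Fin 4 → ℂ) →L[ℝ] ℍ[ℝ] :=
  LinearMap.toContinuousLinearMap
    { toFun := fun c => ⟨(c 0).re, (c 1).re, (c 2).re, (c 3).re⟩
      map_add' := fun c d => by ext <;> rfl
      map_smul' := fun r c => by ext <;> simp <;> rfl }

/-- The quaternion whose components are the imaginary parts of the given complex numbers. -/
noncomputable def imQuat : (Fin 4 → ℂ) →L[ℝ] ℍ[ℝ] :=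
  LinearMap.toContinuousLinearMap
    { toFun := fun c => ⟨(c 0).im, (c 1).im, (c 2).im, (c 3).im⟩
      map_add' := fun c d => by ext <;> rfl
      map_smul' := fun r c => by ext <;> simp <;> rfl }

@[simp] lemma reQuat_re (c : Fin 4 → ℂ) : (reQuat c).re = (c 0).re := rfl

@[simp] lemma reQuat_imI (c : Fin 4 → ℂ) : (reQuat c).imI = (c 1).re := rfl

@[simp] lemma reQuat_imJ (c : Fin 4 → ℂ) : (reQuat c).imJ = (c 2).re := rfl

@[simp] lemma reQuat_imK (c : Fin 4 → ℂ) : (reQuat c).imK = (c 3).re := rfl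

@[simp] lemma imQuat_re (c : Fin 4 → ℂ) : (imQuat c).re = (c 0).im := rfl

@[simp] lemma imQuat_imI (c : Fin 4 → ℂ) : (imQuat c).imI = (c 1).im := rfl

@[simp] lemma imQuat_imJ (c : Fin 4 → ℂ) : (imQuat c).imJ = (c 2).im := rfl

@[simp] lemma imQuat_imK (c : Fin 4 → ℂ) : (imQuat c).imK = (c 3).im := rfl

/-- The value on the slice of `I` of the slice function with the given complex components. -/
noncomputable def sliceVal (I : ℍ[ℝ]) : (Fin 4 → ℂ) →L[ℝ] ℍ[ℝ] :=
  reQuat + (ContinuousLinearMap.mul ℝ ℍ[ℝ] I).comp imQuat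

lemma sliceVal_apply (I : ℍ[ℝ]) (c : Fin 4 → ℂ) : sliceVal I c = reQuat c + I * imQuat c := rfl

/-- Because of this, ∂_I and ∂̄_I act on the components as the Wirtinger derivatives. -/
lemma sliceVal_I_smul {I : ℍ[ℝ]} (hI : I ∈ imagUnits) (c : Fin 4 → ℂ) :
    sliceVal I (Complex.I • c) = I * sliceVal I c := by
  have h1 : reQuat (Complex.I • c) = -imQuat c := by
    ext <;> simp
  have h2 : imQuat (Complex.I • c) = reQuat c := by
    ext <;> simp
  rw [sliceVal_apply, sliceVal_apply, h1, h2, mul_add, ← mul_assoc, imagUnits_mul_self hI]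
  simp [add_comm]

lemma sliceVal_conj (I : ℍ[ℝ]) (c : Fin 4 → ℂ) :
    sliceVal I (fun j => conj (c j)) = sliceVal (-I) c := by
  have h1 : reQuat (fun j => conj (c j)) = reQuat c := by
    ext <;> simp
  have h2 : imQuat (fun j => conj (c j)) = -imQuat c := by
    ext <;> simp
  rw [sliceVal_apply, sliceVal_apply, h1, h2]
  simp

lemma norm_sq_reQuat (c : Fin 4 → ℂ) : ‖reQuat c‖ ^ 2 = ∑ j, (c j).re ^ 2 := by
  rw [pow_two, ← Quaternion.normSq_eq_norm_mul_self, Quaternion.normSq_def',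
    Fin.sum_univ_four]
  simp

lemma norm_sq_imQuat (c : Fin 4 → ℂ) : ‖imQuat c‖ ^ 2 = ∑ j, (c j).im ^ 2 := by
  rw [pow_two, ← Quaternion.normSq_eq_norm_mul_self, Quaternion.normSq_def',
    Fin.sum_univ_four]
  simp

/-- The parallelogram law: a single slice value has a cross term between real and imaginary parts,
which conjugation reverses. -/
lemma norm_sq_sliceVal_add {I : ℍ[ℝ]} (hI : I ∈ imagUnits) (c : Fin 4 → ℂ) :
    ‖sliceVal I c‖ ^ 2 + ‖sliceVal I (fun j => conj (c j))‖ ^ 2 = 2 * ∑ j, ‖c j‖ ^ 2 := by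
  have h := parallelogram_law_with_norm ℝ (reQuat c) (I * imQuat c)
  rw [norm_mul, imagUnits_norm hI, one_mul] at h
  rw [sliceVal_conj, sliceVal_apply, sliceVal_apply, neg_mul, ← sub_eq_add_neg]
  have h1 : ∑ j, ‖c j‖ ^ 2 = ‖reQuat c‖ ^ 2 + ‖imQuat c‖ ^ 2 := by
    rw [norm_sq_reQuat, norm_sq_imQuat, ← Finset.sum_add_distrib]
    refine Finset.sum_congr rfl fun j _ => ?_
    rw [← Complex.normSq_eq_norm_sq, Complex.normSq_apply]
    ring
  rw [h1]
  linarith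

lemma sliceVal_eq_zero {I : ℍ[ℝ]} (hI : I ∈ imagUnits) {c : Fin 4 → ℂ} (h : sliceVal I c = 0)
    (h' : sliceVal (-I) c = 0) : c = 0 := by
  have h1 := norm_sq_sliceVal_add hI c
  rw [sliceVal_conj, h, h'] at h1
  have h2 : ∑ j, ‖c j‖ ^ 2 = 0 := by
    have : (0 : ℝ) = 2 * ∑ j, ‖c j‖ ^ 2 := by simpa using h1
    linarith
  ext j
  have h3 := (Finset.sum_eq_zero_iff_of_nonneg fun j _ => sq_nonneg ‖c j‖).1 h2 j (Finset.mem_univ j)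
  simpa using h3

/-- Families of complex functions that commute with the conjugation. -/
def Intrinsic (g : Fin 4 → ℂ → ℂ) : Prop := ∀ j z, g j (conj z) = conj (g j z)

/-- `f` is the slice function with complex components `g`. -/
def SliceRep (f : ℍ[ℝ] → ℍ[ℝ]) (g : Fin 4 → ℂ → ℂ) : Prop :=
  ∀ I ∈ imagUnits, ∀ z, f (toSlice I z) = sliceVal I (fun j => g j z)

lemma SliceRep.ext {f f' : ℍ[ℝ] → ℍ[ℝ]} {g : Fin 4 → ℂ → ℂ} (h : SliceRep f g)
    (h' : SliceRep f' g) : f = f' := by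
  ext1 q
  rw [← toSlice_sliceUnit q, h _ (sliceUnit_mem_imagUnits q), h' _ (sliceUnit_mem_imagUnits q)]

/-- A common point of two slices is real, where intrinsic components have no imaginary part, or else
I = ±J. For I = −J the points z and w are conjugate, and the two signs compensate. -/
lemma sliceVal_eq_of_toSlice_eq {g : Fin 4 → ℂ → ℂ} (hg : Intrinsic g) {I J : ℍ[ℝ]}
    (hI : I ∈ imagUnits) (hJ : J ∈ imagUnits) {z w : ℂ} (h : toSlice I z = toSlice J w) :
    sliceVal I (fun j => g j z) = sliceVal J (fun j => g j w) := by
  have hre : z.re = w.re := by rw [← toSlice_re hI z, h, toSlice_re hJ]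
  have him : z.im ^ 2 = w.im ^ 2 := by
    have h1 := norm_toSlice hI z
    rw [h, norm_toSlice hJ] at h1
    have h2 : Complex.normSq w = Complex.normSq z := by
      rw [Complex.normSq_eq_norm_sq, Complex.normSq_eq_norm_sq, h1]
    rw [Complex.normSq_apply, Complex.normSq_apply, hre] at h2
    linarith
  have hmul : I * (z.im : ℍ[ℝ]) = J * (w.im : ℍ[ℝ]) := by
    have : toSlice I z = (w.re : ℍ[ℝ]) + I * (z.im : ℍ[ℝ]) := by rw [toSlice, hre]
    rw [this, toSlice] at h
    exact add_left_cancel h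
  by_cases h0 : z.im = 0
  · have hw0 : w.im = 0 := by simpa [h0] using him.symm
    have hzw : z = w := Complex.ext hre (h0.trans hw0.symm)
    subst hzw
    have hz : conj z = z := Complex.conj_eq_iff_im.2 h0
    have hc : ∀ j, (g j z).im = 0 := fun j => by
      rw [← Complex.conj_eq_iff_im, ← hg, hz]
    have : imQuat (fun j => g j z) = 0 := by
      ext <;> simp [hc]
    rw [sliceVal_apply, sliceVal_apply, this]
    simp
  · rcases sq_eq_sq_iff_eq_or_eq_neg.1 him with h1 | h1
    · have hzw : z = w := Complex.ext hre h1
      subst hzw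
      have : (z.im : ℍ[ℝ]) ≠ 0 := fun h => h0 (Quaternion.coe_injective (by simpa using h))
      rw [mul_right_cancel₀ this hmul]
    · have hzw : w = conj z := Complex.ext (by simp [hre]) (by simp [h1])
      subst hzw
      have hne : (z.im : ℍ[ℝ]) ≠ 0 := fun h => h0 (Quaternion.coe_injective (by simpa using h))
      have hIJ : I = -J := by
        refine mul_right_cancel₀ hne ?_
        rw [hmul]; simp
      have : (fun j => g j (conj z)) = fun j => conj (g j z) := funext fun j => hg j z
      rw [this, sliceVal_conj, hIJ]

/-! ### Slice derivatives in components -/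

lemma toSlice_add_smul_one (I : ℍ[ℝ]) (z : ℂ) (t : ℝ) :
    toSlice I z + t • (1 : ℍ[ℝ]) = toSlice I (z + t * 1) := by
  ext <;> simp [toSlice]
  ring

lemma toSlice_add_smul_unit (I : ℍ[ℝ]) (z : ℂ) (t : ℝ) :
    toSlice I z + t • I = toSlice I (z + t * Complex.I) := by
  ext <;> simp [toSlice] <;> ring

lemma lineDeriv_of_toSlice {f : ℍ[ℝ] → ℍ[ℝ]} {g a b : Fin 4 → ℂ → ℂ} {I : ℍ[ℝ]}
    (hf : ∀ z, f (toSlice I z) = sliceVal I (fun j => g j z)) {z : ℂ}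
    (hg : ∀ j, HasWirtingerAt (g j) (a j z) (b j z) z) {v : ℍ[ℝ]} {w : ℂ}
    (hv : ∀ t : ℝ, toSlice I z + t • v = toSlice I (z + t * w)) :
    lineDeriv ℝ f (toSlice I z) v = sliceVal I (fun j => a j z * w + b j z * conj w) := by
  have h1 : HasDerivAt (fun t : ℝ => fun j => g j (z + t * w))
      (fun j => a j z * w + b j z * conj w) 0 :=
    hasDerivAt_pi.2 fun j => (hg j).hasDerivAt_line w
  have h2 := (sliceVal I).hasFDerivAt.comp_hasDerivAt (0 : ℝ) h1
  rw [lineDeriv]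
  simp_rw [hv, hf]
  exact h2.deriv

lemma lineDeriv_one_of_toSlice {f : ℍ[ℝ] → ℍ[ℝ]} {g a b : Fin 4 → ℂ → ℂ} {I : ℍ[ℝ]}
    (hf : ∀ z, f (toSlice I z) = sliceVal I (fun j => g j z)) {z : ℂ}
    (hg : ∀ j, HasWirtingerAt (g j) (a j z) (b j z) z) :
    lineDeriv ℝ f (toSlice I z) 1 =
      sliceVal I (fun j => a j z) + sliceVal I (fun j => b j z) := by
  rw [lineDeriv_of_toSlice hf hg (toSlice_add_smul_one I z), ← map_add]
  congr 1
  ext j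
  simp

lemma lineDeriv_unit_of_toSlice {f : ℍ[ℝ] → ℍ[ℝ]} {g a b : Fin 4 → ℂ → ℂ} {I : ℍ[ℝ]}
    (hI : I ∈ imagUnits) (hf : ∀ z, f (toSlice I z) = sliceVal I (fun j => g j z)) {z : ℂ}
    (hg : ∀ j, HasWirtingerAt (g j) (a j z) (b j z) z) :
    lineDeriv ℝ f (toSlice I z) I =
      I * (sliceVal I (fun j => a j z) - sliceVal I (fun j => b j z)) := by
  rw [lineDeriv_of_toSlice hf hg (toSlice_add_smul_unit I z), ← map_sub, ← sliceVal_I_smul hI]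
  congr 1
  ext j
  simp
  ring

lemma dSlice_of_toSlice {f : ℍ[ℝ] → ℍ[ℝ]} {g a b : Fin 4 → ℂ → ℂ} {I : ℍ[ℝ]}
    (hI : I ∈ imagUnits) (hf : ∀ z, f (toSlice I z) = sliceVal I (fun j => g j z)) {z : ℂ}
    (hg : ∀ j, HasWirtingerAt (g j) (a j z) (b j z) z) :
    dSlice I f (toSlice I z) = sliceVal I (fun j => a j z) := by
  rw [dSlice, lineDeriv_one_of_toSlice hf hg, lineDeriv_unit_of_toSlice hI hf hg, ← mul_assoc,
    imagUnits_mul_self hI, neg_one_mul]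
  module

lemma dbarSlice_of_toSlice {f : ℍ[ℝ] → ℍ[ℝ]} {g a b : Fin 4 → ℂ → ℂ} {I : ℍ[ℝ]}
    (hI : I ∈ imagUnits) (hf : ∀ z, f (toSlice I z) = sliceVal I (fun j => g j z)) {z : ℂ}
    (hg : ∀ j, HasWirtingerAt (g j) (a j z) (b j z) z) :
    dbarSlice I f (toSlice I z) = sliceVal I (fun j => b j z) := by
  rw [dbarSlice, lineDeriv_one_of_toSlice hf hg, lineDeriv_unit_of_toSlice hI hf hg, ← mul_assoc,
    imagUnits_mul_self hI, neg_one_mul]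
  module

/-- The unit chosen by `sliceUnit` may be −I, or unrelated to I at a real point; intrinsic
derivatives make the choice irrelevant. -/
lemma SliceRep.sliceDeriv {f : ℍ[ℝ] → ℍ[ℝ]} {g a b : Fin 4 → ℂ → ℂ} (hf : SliceRep f g)
    (hg : ∀ j z, HasWirtingerAt (g j) (a j z) (b j z) z) (ha : Intrinsic a) :
    SliceRep (sliceDeriv f) a := by
  intro I hI z
  have hJ := sliceUnit_mem_imagUnits (toSlice I z)
  have hq := toSlice_sliceUnit (toSlice I z)
  rw [QBargmann.sliceDeriv]
  nth_rewrite 2 [← hq]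
  rw [dSlice_of_toSlice hJ (hf _ hJ) fun j => hg j _]
  exact sliceVal_eq_of_toSlice_eq ha hJ hI hq

lemma SliceRep.iterate_sliceDeriv {H : ℍ[ℝ] → ℍ[ℝ]} {g : Fin 4 → ℂ → ℂ} (hH : SliceRep H g)
    (hg : ∀ j, Differentiable ℂ (g j)) (hi : Intrinsic g) (n : ℕ) :
    SliceRep (QBargmann.sliceDeriv^[n] (fun p => Real.exp (-(2 * Real.pi) * ‖p‖ ^ 2) • H p))
      (fun j z => gaussWeight z * creation n (g j) z) := by
  induction n with
  | zero =>
    intro I hI z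
    simp only [Function.iterate_zero, id_eq, creation]
    rw [norm_toSlice hI, hH I hI, ← map_smul]
    congr 1
  | succ n ih =>
    rw [Function.iterate_succ_apply']
    refine ih.sliceDeriv (fun j z => hasWirtingerAt_weight_mul_creation n (hg j) z) fun j z => ?_
    rw [gaussWeight_conj, creation_conj _ (hi j), map_mul, Complex.conj_ofReal]

/-- The normalizing constant of the transform `polyRaise n`. -/
noncomputable def raiseConst (n : ℕ) : ℝ :=
  (-1) ^ n * Real.sqrt (1 / ((2 * Real.pi) ^ n * (n.factorial : ℝ)))

lemma SliceRep.polyRaise {H : ℍ[ℝ] → ℍ[ℝ]} {g : Fin 4 → ℂ → ℂ} (hH : SliceRep H g)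
    (hg : ∀ j, Differentiable ℂ (g j)) (hi : Intrinsic g) (n : ℕ) :
    SliceRep (polyRaise n H) (fun j z => raiseConst n * creation n (g j) z) := by
  intro I hI z
  rw [QBargmann.polyRaise, hH.iterate_sliceDeriv hg hi n I hI z, norm_toSlice hI, ← map_smul]
  congr 1
  ext j
  have : Real.exp (2 * Real.pi * ‖z‖ ^ 2) * gaussWeight z = 1 := by
    rw [gaussWeight, ← Real.exp_add]; simp
  have h2 : (Real.exp (2 * Real.pi * ‖z‖ ^ 2) : ℂ) * gaussWeight z = 1 := by exact_mod_cast this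
  simp only [Pi.smul_apply, Complex.real_smul, raiseConst]
  push_cast at h2 ⊢
  linear_combination ((-1) ^ n * (Real.sqrt (1 / ((2 * Real.pi) ^ n * n.factorial)) : ℂ) *
    creation n (g j) z) * h2

/-! ### Slice regularity as holomorphy of the components -/

/-- It supplies Wirtinger derivatives for the components of a slice regular function, which are at
first only real differentiable. -/
lemma clm_complex_eq (L : ℂ →L[ℝ] ℂ) :
    L = ((L 1 - Complex.I * L Complex.I) / 2) • (1 : ℂ →L[ℝ] ℂ) +
      ((L 1 + Complex.I * L Complex.I) / 2) • (Complex.conjCLE : ℂ →L[ℝ] ℂ) := by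
  ext v
  have hv : v = v.re • (1 : ℂ) + v.im • Complex.I := by
    simp [Complex.re_add_im]
  have hLv : L v = v.re * L 1 + v.im * L Complex.I := by
    conv_lhs => rw [hv]
    rw [map_add, map_smul, map_smul, Complex.real_smul, Complex.real_smul]
  have h1 : (v.re : ℂ) + v.im * Complex.I = v := Complex.re_add_im v
  have h2 : conj v = v.re - v.im * Complex.I := by
    apply Complex.ext <;> simp
  simp only [_root_.add_apply, _root_.smul_apply, smul_eq_mul, one_apply_eq_self,
    ContinuousLinearEquiv.coe_coe, Complex.conjCLE_apply]
  rw [hLv, h2]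
  nth_rewrite 3 [← h1]
  linear_combination (v.im * L Complex.I) * Complex.I_mul_I

lemma exists_hasWirtingerAt {f : ℂ → ℂ} {z : ℂ} (hf : DifferentiableAt ℝ f z) :
    ∃ a b, HasWirtingerAt f a b z := by
  refine ⟨(fderiv ℝ f z 1 - Complex.I * fderiv ℝ f z Complex.I) / 2,
    (fderiv ℝ f z 1 + Complex.I * fderiv ℝ f z Complex.I) / 2, ?_⟩
  unfold HasWirtingerAt
  rw [← clm_complex_eq (fderiv ℝ f z)]
  exact hf.hasFDerivAt

lemma HasWirtingerAt.differentiableAt {f : ℂ → ℂ} {a z : ℂ} (hf : HasWirtingerAt f a 0 z) :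
    DifferentiableAt ℂ f z := by
  refine (hasFDerivAt_of_restrictScalars ℝ (f' := a • (1 : ℂ →L[ℂ] ℂ)) hf ?_).differentiableAt
  ext v
  simp

/-- The real coordinates of a quaternion. -/
noncomputable def quatCoord (j : Fin 4) : ℍ[ℝ] →L[ℝ] ℝ :=
  LinearMap.toContinuousLinearMap
    { toFun := fun q => ![q.re, q.imI, q.imJ, q.imK] j
      map_add' := fun p q => by fin_cases j <;> rfl
      map_smul' := fun r q => by fin_cases j <;> rfl }

@[simp] lemma quatCoord_zero (q : ℍ[ℝ]) : quatCoord 0 q = q.re := rfl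

@[simp] lemma quatCoord_one (q : ℍ[ℝ]) : quatCoord 1 q = q.imI := rfl

@[simp] lemma quatCoord_two (q : ℍ[ℝ]) : quatCoord 2 q = q.imJ := rfl

@[simp] lemma quatCoord_three (q : ℍ[ℝ]) : quatCoord 3 q = q.imK := rfl

lemma quat_ext_coord {p q : ℍ[ℝ]} (h : ∀ j, quatCoord j p = quatCoord j q) : p = q :=
  Quaternion.ext _ _ (h 0) (h 1) (h 2) (h 3)

lemma quatCoord_reQuat (j : Fin 4) (c : Fin 4 → ℂ) : quatCoord j (reQuat c) = (c j).re := by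
  fin_cases j <;> rfl

lemma norm_sq_eq_sum_quatCoord (q : ℍ[ℝ]) : ‖q‖ ^ 2 = ∑ j, quatCoord j q ^ 2 := by
  rw [pow_two, ← Quaternion.normSq_eq_norm_mul_self, Quaternion.normSq_def',
    Fin.sum_univ_four]
  simp

/-- A slice function with entire intrinsic components is slice regular. -/
lemma SliceRep.isSliceRegular {f : ℍ[ℝ] → ℍ[ℝ]} {g : Fin 4 → ℂ → ℂ} (hf : SliceRep f g)
    (hg : ∀ j, Differentiable ℂ (g j)) (hi : Intrinsic g) : IsSliceRegular f := by
  have hc : ContDiff ℝ 1 fun p : ℝ × ℝ => fun j => g j (Complex.equivRealProdCLM.symm p) := by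
    refine contDiff_pi.2 fun j => ?_
    have h1 : ContDiff ℝ 1 (g j) := ((hg j).contDiff (n := 1)).restrict_scalars ℝ
    exact h1.comp Complex.equivRealProdCLM.symm.contDiff
  have hconj : ∀ x y : ℝ, (fun j => g j (Complex.equivRealProdCLM.symm (x, -y))) =
      fun j => conj (g j (Complex.equivRealProdCLM.symm (x, y))) := by
    intro x y
    ext j
    rw [← hi]
    congr 1
  have hz : ∀ z : ℂ, Complex.equivRealProdCLM.symm (z.re, z.im) = z := fun z => by
    apply Complex.ext <;> simp
  refine ⟨fun p => reQuat fun j => g j (Complex.equivRealProdCLM.symm p),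
    fun p => imQuat fun j => g j (Complex.equivRealProdCLM.symm p),
    reQuat.contDiff.comp hc, imQuat.contDiff.comp hc, fun x y => ?_, fun x y => ?_,
    fun I hI z => ?_, fun I hI z => ?_⟩
  · simp only [hconj]
    ext <;> simp
  · simp only [hconj]
    ext <;> simp
  · simp only [hz]
    rw [hf I hI z, sliceVal_apply]
  · have h0 : (fun _ : Fin 4 => (0 : ℂ)) = 0 := rfl
    rw [dbarSlice_of_toSlice (b := fun _ _ => 0) hI (hf I hI)
      fun j => HasDerivAt.hasWirtingerAt (hg j z).hasDerivAt, h0, map_zero]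

/-- The complex components of a slice regular function are entire and intrinsic. -/
lemma IsSliceRegular.exists_sliceRep {H : ℍ[ℝ] → ℍ[ℝ]} (hH : IsSliceRegular H) :
    ∃ g, SliceRep H g ∧ (∀ j, Differentiable ℂ (g j)) ∧ Intrinsic g := by
  obtain ⟨α, β, hα, hβ, hαe, hβo, hval, hdbar⟩ := hH
  set g : Fin 4 → ℂ → ℂ := fun j z =>
    (quatCoord j (α (z.re, z.im)) : ℂ) + quatCoord j (β (z.re, z.im)) * Complex.I with hgdef
  have hrep : SliceRep H g := by
    intro I hI z
    rw [hval I hI z, sliceVal_apply]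
    congr 1
    · ext <;> simp [hgdef]
    · congr 1
      ext <;> simp [hgdef]
  have hd : ∀ j, Differentiable ℝ (g j) := by
    intro j
    have h1 : Differentiable ℝ fun z : ℂ => (z.re, z.im) :=
      Complex.equivRealProdCLM.differentiable
    have h2 : ∀ γ : ℝ × ℝ → ℍ[ℝ], ContDiff ℝ 1 γ →
        Differentiable ℝ fun z : ℂ => (quatCoord j (γ (z.re, z.im)) : ℂ) := fun γ hγ =>
      Complex.ofRealCLM.differentiable.comp
        ((quatCoord j).differentiable.comp ((hγ.differentiable one_ne_zero).comp h1))
    exact (h2 α hα).add ((h2 β hβ).mul_const Complex.I)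
  refine ⟨g, hrep, fun j z => ?_, fun j z => ?_⟩
  · choose a b hab using fun (j : Fin 4) (z : ℂ) => exists_hasWirtingerAt (hd j z)
    -- One slice value does not determine the four ∂̄ derivatives, but the values at the same z for
    -- I and −I together do.
    have hI := quatI_mem_imagUnits
    have hI' := neg_mem_imagUnits hI
    have h1 := hdbar _ hI z
    have h2 := hdbar _ hI' z
    rw [dbarSlice_of_toSlice hI (hrep _ hI) fun j => hab j z] at h1
    rw [dbarSlice_of_toSlice hI' (hrep _ hI') fun j => hab j z] at h2
    have h3 : b j z = 0 := congrFun (sliceVal_eq_zero hI h1 h2) j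
    have h4 := hab j z
    rw [h3] at h4
    exact h4.differentiableAt
  · simp [hgdef, hαe, hβo]

/-! ### The quaternionic Bargmann transform -/

lemma toSlice_eq_liftAux {I : ℍ[ℝ]} (hI : I ∈ imagUnits) (z : ℂ) :
    toSlice I z = Complex.liftAux I (imagUnits_mul_self hI) z := by
  rw [Complex.liftAux_apply, toSlice, Quaternion.mul_coe_eq_smul]
  rfl

lemma continuous_toSlice (I : ℍ[ℝ]) : Continuous (toSlice I) :=
  (Quaternion.continuous_coe.comp Complex.continuous_re).add
    (continuous_const.mul (Quaternion.continuous_coe.comp Complex.continuous_im))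

/-- Inclusion of a slice is a continuous real algebra homomorphism from ℂ, so it commutes with the
exponential. -/
lemma bargmannKernel_toSlice {I : ℍ[ℝ]} (hI : I ∈ imagUnits) (z : ℂ) (t : ℝ) :
    bargmannKernel (2 * Real.pi) (toSlice I z) t = toSlice I (scalarKernel z t) := by
  set L := Complex.liftAux I (imagUnits_mul_self hI)
  have hL : ∀ w, toSlice I w = L w := toSlice_eq_liftAux hI
  have hcont : Continuous L := by
    have : (L : ℂ → ℍ[ℝ]) = toSlice I := funext fun w => (hL w).symm
    rw [this]
    exact continuous_toSlice I
  have ht : (t : ℍ[ℝ]) = L (t : ℂ) := (AlgHom.commutes L t).symm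
  have hν : 2 * Real.pi / Real.pi = 2 := by field_simp
  rw [bargmannKernel, hL, hL, ht, ← map_pow, ← map_pow, ← map_add, ← map_mul, ← map_smul,
    ← map_smul, ← map_add, ← NormedSpace.map_exp L hcont, ← map_smul, hν,
    ← Complex.exp_eq_exp_ℂ, scalarKernel, Complex.real_smul]
  congr 3
  simp only [Complex.real_smul]
  push_cast
  ring

/-- The kernel stands on the left of φ, so the real coordinates of φ are transformed separately by
the complex kernel. -/
lemma toSlice_mul_eq_sliceVal (I : ℍ[ℝ]) (k : ℂ) (q : ℍ[ℝ]) :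
    toSlice I k * q = sliceVal I (fun j => k * (quatCoord j q : ℂ)) := by
  have h1 : reQuat (fun j => k * (quatCoord j q : ℂ)) = k.re • q := by ext <;> simp
  have h2 : imQuat (fun j => k * (quatCoord j q : ℂ)) = k.im • q := by ext <;> simp
  rw [sliceVal_apply, h1, h2, toSlice, add_mul, mul_assoc, Quaternion.coe_mul_eq_smul,
    Quaternion.coe_mul_eq_smul]

lemma memLp_quatCoord {φ : ℝ → ℍ[ℝ]} (hφ : MemLp φ 2) (j : Fin 4) :
    MemLp (fun t => (quatCoord j (φ t) : ℂ)) 2 :=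
  (Complex.ofRealCLM.comp (quatCoord j)).comp_memLp' hφ

/-- The complex components of the Bargmann transform. -/
noncomputable def bargmannComp (φ : ℝ → ℍ[ℝ]) (j : Fin 4) : ℂ → ℂ :=
  scalarBargmann fun t => (quatCoord j (φ t) : ℂ)

lemma integrable_bargmannKernel_toSlice {φ : ℝ → ℍ[ℝ]} (hφ : MemLp φ 2) {I : ℍ[ℝ]}
    (hI : I ∈ imagUnits) (z : ℂ) :
    Integrable (fun t => bargmannKernel (2 * Real.pi) (toSlice I z) t * φ t) ∧
      ∫ t, bargmannKernel (2 * Real.pi) (toSlice I z) t * φ t =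
        sliceVal I (fun j => bargmannComp φ j z) := by
  have h1 : ∀ j, Integrable fun t => scalarKernel z t * (quatCoord j (φ t) : ℂ) := fun j =>
    integrable_scalarKernel_mul z (memLp_quatCoord hφ j)
  have h2 : Integrable fun t => fun j => scalarKernel z t * (quatCoord j (φ t) : ℂ) :=
    Integrable.of_eval h1
  simp_rw [bargmannKernel_toSlice hI, toSlice_mul_eq_sliceVal]
  refine ⟨(sliceVal I).integrable_comp h2, ?_⟩
  rw [(sliceVal I).integral_comp_comm h2]
  congr 1
  ext j
  rw [eval_integral h1]
  rfl

lemma integrable_bargmannKernel {φ : ℝ → ℍ[ℝ]} (hφ : MemLp φ 2) (q : ℍ[ℝ]) :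
    Integrable (fun t => bargmannKernel (2 * Real.pi) q t * φ t) := by
  rw [← toSlice_sliceUnit q]
  exact (integrable_bargmannKernel_toSlice hφ (sliceUnit_mem_imagUnits q) _).1

lemma sliceRep_bargmann (φ : L2) : SliceRep (bargmann φ) (bargmannComp φ) := fun _ hI z =>
  (integrable_bargmannKernel_toSlice (Lp.memLp φ) hI z).2

lemma differentiable_bargmannComp (φ : L2) (j : Fin 4) : Differentiable ℂ (bargmannComp φ j) :=
  differentiable_scalarBargmann (memLp_quatCoord (Lp.memLp φ) j)

lemma intrinsic_bargmannComp (φ : L2) : Intrinsic (bargmannComp φ) := fun _ z =>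
  scalarBargmann_ofReal_conj _ z

lemma bargmann_add (φ ψ : L2) : bargmann (φ + ψ) = bargmann φ + bargmann ψ := by
  ext1 q
  rw [Pi.add_apply, bargmann, bargmann, bargmann,
    ← integral_add (integrable_bargmannKernel (Lp.memLp φ) q)
      (integrable_bargmannKernel (Lp.memLp ψ) q)]
  refine integral_congr_ae ?_
  filter_upwards [Lp.coeFn_add φ ψ] with t ht
  rw [ht, Pi.add_apply, mul_add]

lemma bargmann_op_smul (φ : L2) (a : ℍ[ℝ]) :
    bargmann (MulOpposite.op a • φ) = fun q => bargmann φ q * a := by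
  ext1 q
  rw [bargmann, bargmann,
    ← integral_mul_const_of_integrable (integrable_bargmannKernel (Lp.memLp φ) q)]
  refine integral_congr_ae ?_
  filter_upwards [Lp.coeFn_smul (MulOpposite.op a) φ] with t ht
  rw [ht, Pi.smul_apply, op_smul_eq_mul, mul_assoc]

lemma sliceRep_trueBargmann (n : ℕ) (φ : L2) :
    SliceRep (trueBargmann n φ) (fun j z => raiseConst n * creation n (bargmannComp φ j) z) :=
  (sliceRep_bargmann φ).polyRaise (differentiable_bargmannComp φ) (intrinsic_bargmannComp φ) n

lemma trueBargmann_add (n : ℕ) (φ ψ : L2) :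
    trueBargmann n (φ + ψ) = trueBargmann n φ + trueBargmann n ψ := by
  have h1 : SliceRep (bargmann (φ + ψ)) fun j => bargmannComp φ j + bargmannComp ψ j := by
    intro I hI z
    rw [bargmann_add, Pi.add_apply, sliceRep_bargmann φ I hI, sliceRep_bargmann ψ I hI, ← map_add]
    rfl
  refine (h1.polyRaise (fun j => (differentiable_bargmannComp φ j).add
    (differentiable_bargmannComp ψ j)) (fun j z => ?_) n).ext fun I hI z => ?_
  · simp [intrinsic_bargmannComp φ j z, intrinsic_bargmannComp ψ j z]
  · rw [Pi.add_apply, sliceRep_trueBargmann n φ I hI, sliceRep_trueBargmann n ψ I hI, ← map_add]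
    congr 1
    ext j
    simp only [Pi.add_apply]
    rw [creation_add n (differentiable_bargmannComp φ j) (differentiable_bargmannComp ψ j)]
    simp [mul_add]

/-- No differentiability is needed: right multiplication by a ≠ 0 is invertible, so both functions
are differentiable or both derivatives take the default value 0. -/
lemma deriv_mul_const_quaternion (f : ℝ → ℍ[ℝ]) (a : ℍ[ℝ]) (t : ℝ) :
    deriv (fun s => f s * a) t = deriv f t * a := by
  by_cases ha : a = 0
  · simp [ha]
  by_cases hf : DifferentiableAt ℝ f t
  · exact deriv_mul_const hf a
  · have h : ¬ DifferentiableAt ℝ (fun s => f s * a) t := fun h => hf (by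
      simpa [mul_assoc, mul_inv_cancel₀ ha] using h.mul_const a⁻¹)
    rw [deriv_zero_of_not_differentiableAt hf, deriv_zero_of_not_differentiableAt h, zero_mul]

lemma sliceDeriv_mul_const (f : ℍ[ℝ] → ℍ[ℝ]) (a : ℍ[ℝ]) :
    sliceDeriv (fun p => f p * a) = fun p => sliceDeriv f p * a := by
  ext1 q
  simp only [sliceDeriv, dSlice, lineDeriv, deriv_mul_const_quaternion]
  rw [← mul_assoc, ← sub_mul, smul_mul_assoc]

lemma polyRaise_mul_const (n : ℕ) (H : ℍ[ℝ] → ℍ[ℝ]) (a q : ℍ[ℝ]) :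
    polyRaise n (fun p => H p * a) q = polyRaise n H q * a := by
  have h : ∀ (m : ℕ) (f : ℍ[ℝ] → ℍ[ℝ]),
      sliceDeriv^[m] (fun p => f p * a) = fun p => sliceDeriv^[m] f p * a := by
    intro m
    induction m with
    | zero => intro f; rfl
    | succ m ih => intro f; rw [Function.iterate_succ_apply, sliceDeriv_mul_const, ih]; rfl
  simp only [polyRaise, ← smul_mul_assoc]
  rw [h, smul_mul_assoc]

lemma trueBargmann_op_smul (n : ℕ) (φ : L2) (a q : ℍ[ℝ]) :
    trueBargmann n (MulOpposite.op a • φ) q = trueBargmann n φ q * a := by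
  rw [trueBargmann, bargmann_op_smul, polyRaise_mul_const, trueBargmann]

/-! ### Norms on slices and bijectivity -/

/-- The square of the norm on a slice, possibly infinite, is the sum of those of the components. -/
lemma SliceRep.lintegral_norm_sq {f : ℍ[ℝ] → ℍ[ℝ]} {g : Fin 4 → ℂ → ℂ} (hf : SliceRep f g)
    (hg : ∀ j, Continuous (g j)) (hi : Intrinsic g) {I : ℍ[ℝ]} (hI : I ∈ imagUnits) :
    ∫⁻ z : ℂ, ENNReal.ofReal (‖f (toSlice I z)‖ ^ 2 * gaussWeight z) = ∑ j, fockSq (g j) := by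
  have hcg : Continuous fun z => fun j => g j z := continuous_pi hg
  have hm : Measurable fun z : ℂ => ENNReal.ofReal (‖f (toSlice I z)‖ ^ 2 * gaussWeight z) := by
    simp_rw [hf I hI]
    exact (ENNReal.continuous_ofReal.comp ((((sliceVal I).continuous.comp hcg).norm.pow 2).mul
      continuous_gaussWeight)).measurable
  have hconj := (Complex.conjLIE.measurePreserving).lintegral_comp hm
  have hmj : ∀ j, Measurable fun z => ENNReal.ofReal (‖g j z‖ ^ 2 * gaussWeight z) := fun j =>
    (ENNReal.continuous_ofReal.comp (((hg j).norm.pow 2).mul continuous_gaussWeight)).measurable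
  have key : (2 : ℝ≥0∞) * ∫⁻ z : ℂ, ENNReal.ofReal (‖f (toSlice I z)‖ ^ 2 * gaussWeight z) =
      2 * ∑ j, fockSq (g j) := by
    -- One of the two copies is reflected by z ↦ conj z, so that the parallelogram identity applies
    -- pointwise.
    conv_lhs => rw [two_mul]; enter [2]; rw [← hconj]
    rw [← lintegral_add_left hm]
    unfold fockSq
    rw [← lintegral_finsetSum _ fun j _ => hmj j, ← lintegral_const_mul' _ _ (by simp)]
    refine lintegral_congr fun z => ?_
    have hw := (gaussWeight_pos z).le
    have h1 : f (toSlice I (conj z)) = sliceVal I (fun j => conj (g j z)) := by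
      rw [hf I hI]
      congr 1
      ext j
      exact hi j z
    rw [← ENNReal.ofReal_sum_of_nonneg fun j _ => mul_nonneg (sq_nonneg _) hw,
      ← Finset.sum_mul, ← ENNReal.ofReal_ofNat, ← ENNReal.ofReal_mul (by norm_num),
      Complex.conjLIE_apply, h1, gaussWeight_conj, hf I hI,
      ← ENNReal.ofReal_add (mul_nonneg (sq_nonneg _) hw) (mul_nonneg (sq_nonneg _) hw),
      ← add_mul, norm_sq_sliceVal_add hI, mul_assoc]
  exact (ENNReal.mul_right_inj (by simp) (by simp)).1 key

lemma raiseConst_sq (n : ℕ) : raiseConst n ^ 2 * ((2 * Real.pi) ^ n * n.factorial) = 1 := by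
  rw [raiseConst, mul_pow, ← pow_mul, mul_comm n 2, pow_mul, Real.sq_sqrt (by positivity)]
  have : (2 * Real.pi) ^ n * (n.factorial : ℝ) ≠ 0 := by positivity
  rw [Even.neg_one_pow (even_two), one_pow, one_mul, one_div_mul_cancel this]

lemma fockSq_raise (n : ℕ) {g : ℂ → ℂ} (hg : Differentiable ℂ g) :
    fockSq (fun z => raiseConst n * creation n g z) = fockSq g := by
  have h : fockSq (fun z => raiseConst n * creation n g z) =
      ENNReal.ofReal (raiseConst n ^ 2) * fockSq (creation n g) := by
    rw [fockSq, fockSq, ← lintegral_const_mul' _ _ ENNReal.ofReal_ne_top]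
    refine lintegral_congr fun z => ?_
    rw [norm_mul, mul_pow, Complex.norm_real, Real.norm_eq_abs, sq_abs, mul_assoc,
      ENNReal.ofReal_mul (sq_nonneg _)]
  rw [h, fockSq_creation n hg, ← mul_assoc, ← ENNReal.ofReal_mul (sq_nonneg _), raiseConst_sq]
  simp

/-- The right side involves neither n nor I. Infinite values are allowed, so finiteness passes from
the raised function back to the components of `H`. -/
lemma SliceRep.lintegral_norm_sq_polyRaise {H : ℍ[ℝ] → ℍ[ℝ]} {g : Fin 4 → ℂ → ℂ}
    (hH : SliceRep H g) (hg : ∀ j, Differentiable ℂ (g j)) (hi : Intrinsic g) (n : ℕ)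
    {I : ℍ[ℝ]} (hI : I ∈ imagUnits) :
    ∫⁻ z : ℂ, ENNReal.ofReal (‖QBargmann.polyRaise n H (toSlice I z)‖ ^ 2 * gaussWeight z) =
      ∑ j, fockSq (g j) := by
  rw [(hH.polyRaise hg hi n).lintegral_norm_sq
    (fun j => continuous_const.mul (continuous_creation n (hg j))) (fun j z => ?_) hI]
  · exact Finset.sum_congr rfl fun j _ => fockSq_raise n (hg j)
  · rw [creation_conj n (hi j), map_mul, Complex.conj_ofReal]

lemma lintegral_norm_sq_eq {E : Type*} [NormedAddCommGroup E] (φ : Lp E 2 (volume : Measure ℝ)) :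
    ∫⁻ t, ENNReal.ofReal (‖φ t‖ ^ 2) = ENNReal.ofReal (‖φ‖ ^ 2) := by
  have h1 : ‖φ‖ₑ ^ (2 : ℝ) = ∫⁻ t, ‖φ t‖ₑ ^ (2 : ℝ) := by
    rw [Lp.enorm_def, eLpNorm_eq_lintegral_rpow_enorm_toReal (by norm_num) (by norm_num),
      ← ENNReal.rpow_mul]
    simp
  have h2 : ∀ x : ℝ, 0 ≤ x → ENNReal.ofReal (x ^ 2) = ENNReal.ofReal x ^ (2 : ℝ) := by
    intro x hx
    rw [ENNReal.ofReal_rpow_of_nonneg hx (by norm_num)]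
    norm_cast
  rw [h2 _ (norm_nonneg _), ofReal_norm, h1]
  refine lintegral_congr fun t => ?_
  rw [h2 _ (norm_nonneg _), ofReal_norm]

lemma fockSq_scalarBargmann_of_memLp {φ : ℝ → ℂ} (hφ : MemLp φ 2) :
    fockSq (scalarBargmann φ) = ∫⁻ t, ENNReal.ofReal (‖φ t‖ ^ 2) := by
  rw [← scalarBargmann_congr hφ.coeFn_toLp, fockSq_scalarBargmann, ← lintegral_norm_sq_eq]
  refine lintegral_congr_ae ?_
  filter_upwards [hφ.coeFn_toLp] with t ht
  rw [ht]

lemma sum_fockSq_bargmannComp (φ : L2) :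
    ∑ j, fockSq (bargmannComp φ j) = ENNReal.ofReal (‖φ‖ ^ 2) := by
  have hm : ∀ j, AEMeasurable fun t : ℝ => ENNReal.ofReal (‖(quatCoord j (φ t) : ℂ)‖ ^ 2) :=
    fun j => ((memLp_quatCoord (Lp.memLp φ) j).1.norm.pow 2).aemeasurable.ennreal_ofReal
  simp_rw [bargmannComp, fockSq_scalarBargmann_of_memLp (memLp_quatCoord (Lp.memLp φ) _)]
  rw [← lintegral_norm_sq_eq, ← lintegral_finsetSum' _ fun j _ => hm j]
  refine lintegral_congr fun t => ?_
  rw [← ENNReal.ofReal_sum_of_nonneg fun j _ => sq_nonneg _, norm_sq_eq_sum_quatCoord]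
  simp

lemma lintegral_norm_sq_trueBargmann (n : ℕ) (φ : L2) {I : ℍ[ℝ]} (hI : I ∈ imagUnits) :
    ∫⁻ z : ℂ, ENNReal.ofReal (‖trueBargmann n φ (toSlice I z)‖ ^ 2 * gaussWeight z) =
      ENNReal.ofReal (‖φ‖ ^ 2) := by
  rw [trueBargmann, (sliceRep_bargmann φ).lintegral_norm_sq_polyRaise
    (differentiable_bargmannComp φ) (intrinsic_bargmannComp φ) n hI, sum_fockSq_bargmannComp]

lemma continuous_trueBargmann_toSlice (n : ℕ) (φ : L2) {I : ℍ[ℝ]} (hI : I ∈ imagUnits) :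
    Continuous fun z => trueBargmann n φ (toSlice I z) := by
  simp_rw [sliceRep_trueBargmann n φ I hI]
  exact (sliceVal I).continuous.comp (continuous_pi fun j =>
    continuous_const.mul (continuous_creation n (differentiable_bargmannComp φ j)))

lemma integrable_norm_sq_trueBargmann (n : ℕ) (φ : L2) {I : ℍ[ℝ]} (hI : I ∈ imagUnits) :
    Integrable fun z : ℂ => ‖trueBargmann n φ (toSlice I z)‖ ^ 2 * gaussWeight z := by
  refine ⟨(((continuous_trueBargmann_toSlice n φ hI).norm.pow 2).mul
    continuous_gaussWeight).aestronglyMeasurable, ?_⟩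
  rw [hasFiniteIntegral_iff_ofReal (Filter.Eventually.of_forall fun z =>
    mul_nonneg (sq_nonneg _) (gaussWeight_pos z).le), lintegral_norm_sq_trueBargmann n φ hI]
  exact ENNReal.ofReal_lt_top

lemma integral_norm_sq_trueBargmann (n : ℕ) (φ : L2) {I : ℍ[ℝ]} (hI : I ∈ imagUnits) :
    ∫ z : ℂ, ‖trueBargmann n φ (toSlice I z)‖ ^ 2 * gaussWeight z = ‖φ‖ ^ 2 := by
  rw [integral_eq_lintegral_of_nonneg_ae (Filter.Eventually.of_forall fun z =>
    mul_nonneg (sq_nonneg _) (gaussWeight_pos z).le)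
    (integrable_norm_sq_trueBargmann n φ hI).1, lintegral_norm_sq_trueBargmann n φ hI,
    ENNReal.toReal_ofReal (sq_nonneg _)]

lemma exp_norm_toSlice {I : ℍ[ℝ]} (hI : I ∈ imagUnits) (z : ℂ) :
    Real.exp (-(2 * Real.pi) * ‖toSlice I z‖ ^ 2) = gaussWeight z := by
  rw [norm_toSlice hI, gaussWeight]

lemma fockNorm_trueBargmann (n : ℕ) (φ : L2) {I : ℍ[ℝ]} (hI : I ∈ imagUnits) :
    fockNorm I (trueBargmann n φ) = ‖φ‖ := by
  simp_rw [fockNorm, exp_norm_toSlice hI]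
  rw [integral_norm_sq_trueBargmann n φ hI, Real.sqrt_sq (norm_nonneg _)]

lemma isSliceRegular_bargmann (φ : L2) : IsSliceRegular (bargmann φ) :=
  (sliceRep_bargmann φ).isSliceRegular (differentiable_bargmannComp φ) (intrinsic_bargmannComp φ)

lemma injective_trueBargmann (n : ℕ) : Function.Injective (trueBargmann n) := by
  intro φ ψ h
  have h1 : trueBargmann n (φ - ψ) = 0 := by
    have := trueBargmann_add n (φ - ψ) ψ
    rw [sub_add_cancel, h] at this
    simpa using this
  have h2 := fockNorm_trueBargmann n (φ - ψ) quatI_mem_imagUnits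
  rw [h1] at h2
  have h3 : ‖φ - ψ‖ = 0 := by rw [← h2]; simp [fockNorm]
  exact sub_eq_zero.1 (norm_eq_zero.1 h3)

/-- Slice regular functions with components of finite Fock norm are Bargmann transforms. -/
lemma exists_bargmann_eq {H : ℍ[ℝ] → ℍ[ℝ]} {g : Fin 4 → ℂ → ℂ} (hH : SliceRep H g)
    (hg : ∀ j, Differentiable ℂ (g j)) (hi : Intrinsic g) (hfin : ∀ j, fockSq (g j) < ∞) :
    ∃ φ : L2, bargmann φ = H := by
  choose ψ hψ using fun j => exists_scalarBargmann_eq (hg j) (hfin j)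
  -- The complex preimages need not be real; their real parts have the same transforms by
  -- `scalarBargmann_re` and are the coordinates of one quaternionic function.
  have hmem : MemLp (fun t => reQuat fun j => ψ j t) 2 :=
    reQuat.comp_memLp' (MemLp.of_eval fun j => Lp.memLp (ψ j))
  refine ⟨hmem.toLp, (sliceRep_bargmann _).ext ?_⟩
  have hcomp : bargmannComp hmem.toLp = g := by
    ext1 j
    rw [← hψ j, ← scalarBargmann_re (Lp.memLp (ψ j)) (by rw [hψ j]; exact hi j), bargmannComp]
    refine scalarBargmann_congr ?_
    filter_upwards [hmem.coeFn_toLp] with t ht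
    rw [ht, quatCoord_reQuat]
  rw [hcomp]
  exact hH

lemma bijOn_trueBargmann (n : ℕ) {I : ℍ[ℝ]} (hI : I ∈ imagUnits) :
    Set.BijOn (trueBargmann n) Set.univ (trueFock n I) := by
  refine ⟨fun φ _ => ⟨?_, bargmann φ, isSliceRegular_bargmann φ, rfl⟩,
    (injective_trueBargmann n).injOn, ?_⟩
  · simp_rw [exp_norm_toSlice hI]
    exact integrable_norm_sq_trueBargmann n φ hI
  · rintro f ⟨hint, H, hH, rfl⟩
    obtain ⟨g, hrep, hg, hi⟩ := hH.exists_sliceRep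
    simp_rw [exp_norm_toSlice hI] at hint
    have h1 := hint.lintegral_lt_top
    rw [hrep.lintegral_norm_sq_polyRaise hg hi n hI, ENNReal.sum_lt_top] at h1
    obtain ⟨φ, hφ⟩ := exists_bargmann_eq hrep hg hi fun j => h1 j (Finset.mem_univ j)
    exact ⟨φ, Set.mem_univ φ, by rw [trueBargmann, hφ]⟩

/-! ### Polarization and inner products -/

/-- The `j`-th element of the standard basis of the quaternions. -/
noncomputable def quatBasis (j : Fin 4) : ℍ[ℝ] := reQuat (Pi.single j 1)

/-- For e the j-th basis element, the difference of the squares is 4 Re (conj (q e) p), and Re (conj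
e r) is the j-th coordinate of r = conj q p. -/
lemma quatCoord_star_mul (j : Fin 4) (p q : ℍ[ℝ]) :
    quatCoord j (star q * p) =
      (1 / 4) * (‖p + q * quatBasis j‖ ^ 2 - ‖p + q * -quatBasis j‖ ^ 2) := by
  rw [norm_sq_eq_sum_quatCoord, norm_sq_eq_sum_quatCoord, Fin.sum_univ_four, Fin.sum_univ_four]
  fin_cases j <;> simp [quatBasis] <;> ring

lemma integrable_star_mul {X : Type*} [MeasurableSpace X] {μ : Measure X} {F G : X → ℍ[ℝ]}
    (hF : MemLp F 2 μ) (hG : MemLp G 2 μ) : Integrable (fun x => star (G x) * F x) μ :=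
  hG.star.integrable_mul hF

lemma integrable_norm_sq_add_mul {X : Type*} [MeasurableSpace X] {μ : Measure X} {F G : X → ℍ[ℝ]}
    (hF : MemLp F 2 μ) (hG : MemLp G 2 μ) (a : ℍ[ℝ]) :
    Integrable (fun x => ‖F x + G x * a‖ ^ 2) μ := by
  have hm : MemLp (fun x => F x + G x * a) 2 μ :=
    hF.add (((ContinuousLinearMap.mul ℝ ℍ[ℝ]).flip a).comp_memLp' hG)
  exact (memLp_two_iff_integrable_sq_norm hm.1).1 hm

/-- Polarization: the quaternionic inner product is determined by the norms. -/
lemma integral_star_mul_eq {X Y : Type*} [MeasurableSpace X] [MeasurableSpace Y]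
    {μ : Measure X} {ν : Measure Y} {F G : X → ℍ[ℝ]} {F' G' : Y → ℍ[ℝ]}
    (hF : MemLp F 2 μ) (hG : MemLp G 2 μ) (hF' : MemLp F' 2 ν) (hG' : MemLp G' 2 ν)
    (h : ∀ a : ℍ[ℝ], ∫ x, ‖F x + G x * a‖ ^ 2 ∂μ = ∫ y, ‖F' y + G' y * a‖ ^ 2 ∂ν) :
    ∫ x, star (G x) * F x ∂μ = ∫ y, star (G' y) * F' y ∂ν := by
  refine quat_ext_coord fun j => ?_
  rw [← (quatCoord j).integral_comp_comm (integrable_star_mul hF hG),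
    ← (quatCoord j).integral_comp_comm (integrable_star_mul hF' hG')]
  simp_rw [quatCoord_star_mul]
  rw [integral_const_mul, integral_const_mul, integral_sub (integrable_norm_sq_add_mul hF hG _)
    (integrable_norm_sq_add_mul hF hG _), integral_sub (integrable_norm_sq_add_mul hF' hG' _)
    (integrable_norm_sq_add_mul hF' hG' _), h, h]

lemma integral_norm_sq_L2 (φ : L2) : ∫ t, ‖φ t‖ ^ 2 = ‖φ‖ ^ 2 := by
  rw [integral_eq_lintegral_of_nonneg_ae (Filter.Eventually.of_forall fun t => sq_nonneg _)
    ((Lp.memLp φ).1.norm.pow 2), lintegral_norm_sq_eq, ENNReal.toReal_ofReal (sq_nonneg _)]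

lemma memLp_weighted_trueBargmann (n : ℕ) (φ : L2) {I : ℍ[ℝ]} (hI : I ∈ imagUnits) :
    MemLp (fun z => Real.sqrt (gaussWeight z) • trueBargmann n φ (toSlice I z)) 2 := by
  have hc : Continuous fun z => Real.sqrt (gaussWeight z) • trueBargmann n φ (toSlice I z) :=
    continuous_gaussWeight.sqrt.smul (continuous_trueBargmann_toSlice n φ hI)
  rw [memLp_two_iff_integrable_sq_norm hc.aestronglyMeasurable]
  refine (integrable_norm_sq_trueBargmann n φ hI).congr (Filter.Eventually.of_forall fun z => ?_)
  simp only
  rw [norm_smul, mul_pow, Real.norm_of_nonneg (Real.sqrt_nonneg _),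
    Real.sq_sqrt (gaussWeight_pos z).le, mul_comm]

lemma weight_smul_star_mul (z : ℂ) (p q : ℍ[ℝ]) :
    gaussWeight z • (star q * p) =
      star (Real.sqrt (gaussWeight z) • q) * (Real.sqrt (gaussWeight z) • p) := by
  rw [Quaternion.star_smul, smul_mul_smul_comm, Real.mul_self_sqrt (gaussWeight_pos z).le]

lemma integrable_fockInner_trueBargmann (n : ℕ) (φ ψ : L2) {I : ℍ[ℝ]} (hI : I ∈ imagUnits) :
    Integrable fun z : ℂ => Real.exp (-(2 * Real.pi) * ‖toSlice I z‖ ^ 2) •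
      (star (trueBargmann n ψ (toSlice I z)) * trueBargmann n φ (toSlice I z)) := by
  simp_rw [exp_norm_toSlice hI, weight_smul_star_mul]
  exact integrable_star_mul (memLp_weighted_trueBargmann n φ hI)
    (memLp_weighted_trueBargmann n ψ hI)

lemma fockInner_trueBargmann (n : ℕ) (φ ψ : L2) {I : ℍ[ℝ]} (hI : I ∈ imagUnits) :
    fockInner I (trueBargmann n φ) (trueBargmann n ψ) = l2Inner φ ψ := by
  rw [fockInner, l2Inner]
  simp_rw [exp_norm_toSlice hI, weight_smul_star_mul]
  refine integral_star_mul_eq (memLp_weighted_trueBargmann n φ hI)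
    (memLp_weighted_trueBargmann n ψ hI) (Lp.memLp φ) (Lp.memLp ψ) fun a => ?_
  -- By right linearity the combination of the transforms is the transform of φ + ψ a, so
  -- polarization only needs the isometry.
  trans ‖φ + MulOpposite.op a • ψ‖ ^ 2
  · rw [← integral_norm_sq_trueBargmann n _ hI]
    refine integral_congr_ae (Filter.Eventually.of_forall fun z => ?_)
    simp only
    rw [smul_mul_assoc, ← smul_add, norm_smul, mul_pow, Real.norm_of_nonneg (Real.sqrt_nonneg _),
      Real.sq_sqrt (gaussWeight_pos z).le, trueBargmann_add, Pi.add_apply, trueBargmann_op_smul,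
      mul_comm]
  · rw [← integral_norm_sq_L2]
    refine integral_congr_ae ?_
    filter_upwards [Lp.coeFn_add φ (MulOpposite.op a • ψ), Lp.coeFn_smul (MulOpposite.op a) ψ]
      with t h1 h2
    rw [h1, Pi.add_apply, h2, Pi.smul_apply, op_smul_eq_mul]

end QBargmann

theorem mainTheorem2 (n : ℕ) :
    -- the transform is well defined on `L²(ℝ, ℍ)`
    (∀ φ : QBargmann.L2,
      (∀ q : ℍ[ℝ], Integrable
        (fun x : ℝ => QBargmann.bargmannKernel (2 * Real.pi) q x * φ x) volume) ∧
      QBargmann.IsSliceRegular (QBargmann.bargmann φ)) ∧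
    -- it is right linear over the quaternions
    (∀ φ ψ : QBargmann.L2, QBargmann.trueBargmann n (φ + ψ) =
      QBargmann.trueBargmann n φ + QBargmann.trueBargmann n ψ) ∧
    (∀ (φ : QBargmann.L2) (a : ℍ[ℝ]) (q : ℍ[ℝ]),
      QBargmann.trueBargmann n (MulOpposite.op a • φ) q = QBargmann.trueBargmann n φ q * a) ∧
    -- for every slice, it is a bijection onto the true polyanalytic Fock space that preserves
    -- norms and inner products
    ∀ I ∈ QBargmann.imagUnits,
      Set.BijOn (QBargmann.trueBargmann n) Set.univ (QBargmann.trueFock n I) ∧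
      (∀ φ : QBargmann.L2, QBargmann.fockNorm I (QBargmann.trueBargmann n φ) = ‖φ‖) ∧
      (∀ φ ψ : QBargmann.L2,
        Integrable (fun z : ℂ =>
          Real.exp (-(2 * Real.pi) * ‖QBargmann.toSlice I z‖ ^ 2) •
            (star (QBargmann.trueBargmann n ψ (QBargmann.toSlice I z)) *
              QBargmann.trueBargmann n φ (QBargmann.toSlice I z))) ∧
        QBargmann.fockInner I (QBargmann.trueBargmann n φ) (QBargmann.trueBargmann n ψ) =
          QBargmann.l2Inner φ ψ) := by
  refine ⟨fun φ => ⟨fun q => QBargmann.integrable_bargmannKernel (MeasureTheory.Lp.memLp φ) q,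
    QBargmann.isSliceRegular_bargmann φ⟩, QBargmann.trueBargmann_add n,
    QBargmann.trueBargmann_op_smul n, fun I hI => ⟨QBargmann.bijOn_trueBargmann n hI,
    fun φ => QBargmann.fockNorm_trueBargmann n φ hI,
    fun φ ψ => ⟨QBargmann.integrable_fockInner_trueBargmann n φ ψ hI,
      QBargmann.fockInner_trueBargmann n φ ψ hI⟩⟩⟩
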